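/- Let $S\simeq(\mathbf R^2\smallsetminus\mathbf Z^2)/\mathbf Z^2$ be the (open) one-holed torus, whose fundamental group $\pi_1(S)=\mathbb F_2=\langle x,y\rangle$ is free on the loops $x,y$ of directions $(1,0),(0,1)$. For coprime $(q,p)\in\mathbf Z^2$ let $\gamma_{p/q}\in\mathbb F_2$ be an element representing a simple closed curve of slope $p/q\in\mathbf Q\cup\{1/0\}$ (it is unique up to conjugation and inversion). For a representation $\rho:\mathbb F_2\to\mathrm{PSL}_2\mathbf R$ write $\lambda_\rho(\gamma)=\inf_{z\in\mathbb H^2} d(z,\rho(\gamma)z)$ for the translation length of $\rho(\gamma)$. For every $\kappa>1$ there is $\delta>0$ such that the following holds. Let $\tau$ be a hyperbolic triangle with pairwise distinct vertices in $\mathbb H^2$, all of whose inner angles are $\le\delta$, with side lengths $a,b,c$ satisfying $\max\{a,b,c\}/\min\{a,b,c\}\le\kappa$. Let $\rho_\tau:\pi_1(S)\to\mathrm{PSL}_2\mathbf R$ be the holonomy representation of an infinite-volume complete hyperbolic structure on $S$ such that $$\big(\lambda_{\rho_\tau}(\gamma_{0/1}),\lambda_{\rho_\tau}(\gamma_{1/1}),\lambda_{\rho_\tau}(\gamma_{1/0})\big)=(2a,2b,2c).$$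 Then there is a unique continuous function $L_\tau:\mathbf R^2\to\mathbf R_{\ge 0}$ such that $L_\tau(q,p)=\frac1{2a}\lambda_{\rho_\tau}(\gamma_{p/q})$ for all coprime $(q,p)\in\mathbf Z^2$ and $L_\tau(tv)=|t|\,L_\tau(v)$ for all $t\in\mathbf R$, $v\in\mathbf R^2$. This function $L_\tau$ is convex. Moreover, for every coprime pair $(q,p)\in\mathbf Z^2$, the ray $\{(tq,tp,L_\tau(tq,tp)) : t\ge 0\}$ is an extremal ray of the convex region $\{(u,v,z)\in\mathbf R^3 : z\ge L_\tau(u,v)\}$ above the graph of $L_\tau$ (if a point of the ray lies in an open segment with endpoints in the region, then these endpoints lie on the ray), and there are at least two distinct supporting planes of this region that contain the ray. -/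

import Mathlib

open scoped UpperHalfPlane MatrixGroups ComplexConjugate

noncomputable section

namespace OneHoledTorus

/-! ### The action of `PSL(2, ℝ)` on the hyperbolic plane -/

/-- The action of `PSL(2, ℝ)` on the hyperbolic plane `ℍ` by Möbius transformations, induced by
Mathlib's action of `SL(2, ℝ)` on `ℍ`. -/
def moebius : PSL(2, ℝ) →* Equiv.Perm ℍ :=
  QuotientGroup.lift (Subgroup.center SL(2, ℝ)) (MulAction.toPermHom SL(2, ℝ) ℍ) (by
    intro g hg
    obtain ⟨r, hr, hrg⟩ := Matrix.SpecialLinearGroup.mem_center_iff.mp hg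
    have hr2 : r ^ 2 = 1 := by simpa using hr
    have hr0 : (r : ℂ) ≠ 0 := by
      intro h
      have : r = 0 := by exact_mod_cast h
      simp [this] at hr2
    have h00 : g 0 0 = r := by
      have := congrFun (congrFun hrg 0) 0
      simpa using this.symm
    have h01 : g 0 1 = 0 := by
      have := congrFun (congrFun hrg 0) 1
      simpa using this.symm
    have h10 : g 1 0 = 0 := by
      have := congrFun (congrFun hrg 1) 0
      simpa using this.symm
    have h11 : g 1 1 = r := by
      have := congrFun (congrFun hrg 1) 1
      simpa using this.symm
    ext z
    simp [UpperHalfPlane.coe_specialLinearGroup_apply, h00, h01, h10, h11, hr0])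

/-- The translation length `λ(g) = inf_z d(z, g z)` of `g ∈ PSL(2, ℝ)` acting on `ℍ`. -/
def translationLength (g : PSL(2, ℝ)) : ℝ := ⨅ z : ℍ, dist z (moebius g z)

/-- The angle at the vertex `z` of the hyperbolic triangle `z w₁ w₂`, for `w₁ ≠ z`, `w₂ ≠ z`: the
Cayley transform `w ↦ (w - z) / (w - conj z)` is a conformal map from `ℍ` onto the unit disc that
sends `z` to `0` and the geodesics issued from `z` to Euclidean radii. -/
def angleAt (z w₁ w₂ : ℍ) : ℝ :=
  InnerProductGeometry.angle (((w₁ : ℂ) - z) / (w₁ - conj (z : ℂ)))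
    (((w₂ : ℂ) - z) / (w₂ - conj (z : ℂ)))

/-! ### The one-holed torus and its simple closed curves

`S` is the one-holed torus, identified with the quotient of `ℝ² ∖ ℤ²` by the translations in `ℤ²`.
Its fundamental group is the free group on `x` (the loop of slope `0`, direction `(1, 0)`) and
`y` (the loop of slope `∞`, direction `(0, 1)`). -/

/-- The fundamental group of the one-holed torus. -/
abbrev F₂ : Type := FreeGroup (Fin 2)

/-- The loop of direction `(1, 0)`. -/
def x : F₂ := FreeGroup.of 0

/-- The loop of direction `(0, 1)`. -/
def y : F₂ := FreeGroup.of 1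

/-- The word read along a closed straight line of direction `(n, m)` in the torus, `n > 0`, passing
just above a lattice point: a letter `x` for each of the `n` unit steps to the right, and, in the
`i`-th step, a letter `y` (or `y⁻¹`) for each horizontal line of the lattice `ℤ²` crossed upwards
(or downwards). -/
def lineWord (n : ℕ) (m : ℤ) : F₂ :=
  ((List.range n).map fun i : ℕ => x * y ^ (((i + 1 : ℤ) * m) / n - ((i : ℤ) * m) / n)).prod

/-- For coprime `q, p`, an element `γ_{p/q}` of the fundamental group representing the simple closed
curve of slope `p / q` (such an element is unique up to conjugation and inversion). -/
def slopeCurve (q p : ℤ) : F₂ :=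
  if q = 0 then y else lineWord q.natAbs (q.sign * p)

/-! ### Complete hyperbolic structures on the one-holed torus -/

/-- The modular torus: the holonomy of the classical finite-volume hyperbolic structure on `S`.
It serves as a model for the action of the fundamental group by deck transformations on the
universal cover of the (open) surface `S`, which is identified with `ℍ`. -/
def deck : F₂ →* PSL(2, ℝ) :=
  (QuotientGroup.mk' (Subgroup.center SL(2, ℝ))).comp
    (FreeGroup.lift
      ![(⟨!![1, 1; 1, 2], by norm_num [Matrix.det_fin_two]⟩ : SL(2, ℝ)),
        (⟨!![1, -1; -1, 2], by norm_num [Matrix.det_fin_two]⟩ : SL(2, ℝ))])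

/-- `ρ` is the holonomy representation of a complete hyperbolic structure on `S`: there is a
developing homeomorphism from the universal cover of `S` onto `ℍ` that is `ρ`-equivariant (and so
descends to a homeomorphism from `S` onto `ρ(F₂) \ ℍ` inducing `ρ` on fundamental groups). -/
def IsHolonomy (ρ : F₂ →* PSL(2, ℝ)) : Prop :=
  ∃ dev : ℍ ≃ₜ ℍ, ∀ (g : F₂) (z : ℍ), dev (moebius (deck g) z) = moebius (ρ g) (dev z)

/-- The quotient `ρ(F₂) \ ℍ` has infinite hyperbolic area: every measurable set whose translates
cover `ℍ` has infinite area. -/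
def HasInfiniteVolume (ρ : F₂ →* PSL(2, ℝ)) : Prop :=
  ∀ D : Set ℍ, MeasurableSet D → (⋃ g : F₂, moebius (ρ g) '' D) = Set.univ →
    MeasureTheory.volume D = ⊤

/-- The length `λ_ρ(γ)` of (the free homotopy class of) `γ` in the structure with holonomy `ρ`. -/
def curveLength (ρ : F₂ →* PSL(2, ℝ)) (γ : F₂) : ℝ := translationLength (ρ γ)

/-- `L : ℝ² → ℝ_{≥ 0}` is a continuous homogeneous function with
`L(q, p) = λ_ρ(γ_{p/q}) / (2 a)` for all coprime `(q, p) ∈ ℤ²`. -/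
structure IsLengthExtension (ρ : F₂ →* PSL(2, ℝ)) (a : ℝ) (L : ℝ × ℝ → ℝ) : Prop where
  nonneg : ∀ v, 0 ≤ L v
  apply_coprime : ∀ q p : ℤ, IsCoprime q p →
    L ((q : ℝ), (p : ℝ)) = 1 / (2 * a) * curveLength ρ (slopeCurve q p)
  homogeneous : ∀ (t : ℝ) (v : ℝ × ℝ), L (t • v) = |t| * L v
  continuous : Continuous L

/-! ### Convexity -/

/-- The region above the graph of `L`. -/
def regionAbove (L : ℝ × ℝ → ℝ) : Set ((ℝ × ℝ) × ℝ) := {w | L w.1 ≤ w.2}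

/-- The ray `{(t q, t p, L(t q, t p)) : t ≥ 0}` of the graph of `L`. -/
def graphRay (L : ℝ × ℝ → ℝ) (q p : ℤ) : Set ((ℝ × ℝ) × ℝ) :=
  {w | ∃ t : ℝ, 0 ≤ t ∧ w = ((t * q, t * p), L (t * q, t * p))}

/-- `H` is an affine plane in `ℝ³` that supports the set `E` and touches it along the set `F`. -/
structure IsSupportingPlaneAlong (E F H : Set ((ℝ × ℝ) × ℝ)) : Prop where
  exists_form : ∃ (φ : (ℝ × ℝ) × ℝ →ₗ[ℝ] ℝ) (c : ℝ), φ ≠ 0 ∧ H = {w | φ w = c} ∧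
    ∀ w ∈ E, c ≤ φ w
  subset : F ⊆ E ∩ H

end OneHoledTorus

end

/-!
Write `A`, `B` for lifts of `ρ x`, `ρ y` to `SL(2, ℝ)` with positive traces, and `t (q, p)` for the
trace of `γ_{p/q}`. The proof has a topological, an algebraic and a convex-geometric part.

*Topology.* Hyperbolic elements `A`, `B` have crossing axes if and only if `tr [A, B] < 2`. For the
modular torus the axes of `x` and `y` cross, and crossing is invariant under equivariant
homeomorphisms of the plane (`fricke_neg_of_homeomorph`): such a homeomorphism must send the two
sides of the axis of `x` to different sides of the axis of `A`, up to tubes around these axes,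
because one side of an axis is not compact modulo translations along the axis (`exists_sides`); and
an orbit of `y` accumulates on both sides of the axis of `x`, whereas the axis of `B` would stay on
one side of the axis of `A` if they did not cross. Hence `tr [A, B] < 2`.

*Algebra.* For a basis `u`, `u'` of `ℤ²` in the right half-plane the word of a line of direction
`u + u'` is the product of the words for `u` and `u'` (`slopeCurve_add`), so that
`t (u + u') + t (u - u') = t u * t u'` for all bases (`slopeTrace_add_sub`). Therefore
`t (w + n v) = α eⁿᵃ + β e⁻ⁿᵃ`, where `a = h v` is half the length of `v`, and `tr [A, B] < 2` says
precisely that `α β > 1`. So `h (w + n v)` is at least both `|n a + log α|` and `|n a - log β|`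
(`IsMarkov.exists_asymptotes`): the linear forms with values `h v` at `v` and `log α`, or `-log β`,
at `w` are two distinct minorants of `h` on the neighbours of `v` in the Farey graph.

*Convexity.* The same formulas show that `h` is subadditive on bases and that the piecewise linear
interpolations of `h` on Farey fans are convex, and this implies that a linear form that supports
`h` at `v` relative to the neighbours of `v` is at most `h` on all primitive vectors
(`IsFareyConvex.linear_le`). The supremum `L` of all linear forms that are at most `h` on primitive
vectors is then equal to `h` there; it is convex, hence continuous, and it is determined by its
values on primitive vectors, whose multiples are dense. The two supporting forms at `v` give two
supporting planes, which meet the region above the graph of `L` only along the ray through `v`; this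
ray is therefore extremal.
-/

namespace OneHoledTorus

/-! ### Convexity along the Farey graph -/

/-- An even function on the primitive vectors of `ℤ²` that is convex along the Farey graph: it is
subadditive on every basis, and the piecewise linear function that interpolates it on a fan of
consecutive bases is convex across each ray. Apart from
evenness, the values at vectors that are not primitive are not constrained. -/
structure IsFareyConvex (h : ℤ → ℤ → ℝ) : Prop where
  even : ∀ q p, h (-q) (-p) = h q p
  subadd : ∀ q p q' p', q * p' - p * q' = 1 → h (q + q') (p + p') ≤ h q p + h q' p'
  convex : ∀ q p q' p' k : ℤ, q * p' - p * q' = 1 →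
    (k : ℝ) * h q p ≤ h q' p' + h (k * q - q') (k * p - p')

/-- The difference `D` of `h` and any linear form that agrees with `h` at `(1, 0)` satisfies
`D (q', p') / p' ≤ D (q, p) / p` for every basis `(q', p')`, `(q, p)` of the upper half-plane: the
slope of `D` on the line of ordinate `1` is monotone. The linear form cancels out of the inequality
up to the term `h (1, 0)`. -/
theorem IsFareyConvex.mul_le_mul_add {h : ℤ → ℤ → ℝ} (H : IsFareyConvex h) (N : ℕ) :
    ∀ q p q' p' : ℤ, 1 ≤ p → 1 ≤ p' → q' * p - p' * q = 1 → p + p' ≤ N →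
      p * h q' p' ≤ p' * h q p + h 1 0 := by
  induction N with
  | zero => intro q p q' p' h1 h2 _ h4; exfalso; push_cast at h4; omega
  | succ N ih =>
    intro q p q' p' hp hp' hdet hN
    push_cast at hN
    rcases lt_trichotomy p p' with hlt | heq | hgt
    · have h1 := ih q p (q' - q) (p' - p) hp (by omega) (by linear_combination hdet) (by omega)
      have h2 := H.subadd (q' - q) (p' - p) q p (by linear_combination hdet)
      simp only [sub_add_cancel] at h2
      push_cast at h1
      have hp0 : (0 : ℝ) ≤ p := by exact_mod_cast (by omega : 0 ≤ p)
      nlinarith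
    · subst heq
      have h1 : p * (q' - q) = 1 := by linear_combination hdet
      have h2 : p = 1 := by
        rcases Int.eq_one_or_neg_one_of_mul_eq_one h1 with h | h <;> omega
      subst h2
      have h3 := H.subadd 1 0 q 1 (by ring)
      have h4 : q' = 1 + q := by omega
      subst h4
      simp only [zero_add] at h3
      push_cast
      linarith
    · rcases hp'.eq_or_lt with h1 | h1
      · subst h1
        have h2 := H.convex q' 1 q p p (by linear_combination hdet)
        have h3 : p * q' - q = 1 := by linear_combination hdet
        simp only [mul_one, sub_self, h3] at h2
        push_cast
        linarith
      · -- `(k * q' - q, k * p' - p)` is the neighbour of `(q', p')` of smallest height to its right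
        obtain ⟨k, hk0, hk1⟩ : ∃ k : ℤ, 0 ≤ k * p' - p ∧ k * p' - p < p' := by
          refine ⟨-(-p / p'), ?_, ?_⟩
          · have := Int.ediv_mul_le (-p) (by omega : p' ≠ 0)
            linarith
          · have := Int.lt_ediv_add_one_mul_self (-p) (by omega : 0 < p')
            linarith
        have hk2 : k * p' - p ≠ 0 := by
          intro h0
          have : p' * (q' * k - q) = 1 := by linear_combination hdet + q' * h0
          rcases Int.eq_one_or_neg_one_of_mul_eq_one this with h | h <;> omega
        have h2 := ih q' p' (k * q' - q) (k * p' - p) (by omega) (by omega)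
          (by linear_combination hdet) (by omega)
        have h3 := H.convex q' p' q p k (by linear_combination hdet)
        have hp0 : (0 : ℝ) ≤ p' := by exact_mod_cast (by omega : 0 ≤ p')
        push_cast at h2
        nlinarith

/-- A linear form that agrees with `h` at `(1, 0)` and is at most `h` on the neighbours `(n, 1)` of
`(1, 0)` is at most `h` on the upper half-plane. -/
theorem IsFareyConvex.le_of_pos {h : ℤ → ℤ → ℝ} (H : IsFareyConvex h) {σ : ℝ}
    (hσ : ∀ n : ℤ, n * h 1 0 + σ ≤ h n 1) (N : ℕ) :
    ∀ q p : ℤ, 1 ≤ p → p ≤ N → IsCoprime q p → q * h 1 0 + p * σ ≤ h q p := by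
  induction N with
  | zero => intro q p h1 h2 _; exfalso; push_cast at h2; omega
  | succ N ih =>
    intro q p hp hN hc
    push_cast at hN
    rcases hp.eq_or_lt with h1 | h1
    · subst h1; simpa using hσ q
    · obtain ⟨u, v, huv⟩ := hc
      obtain ⟨r, s, hs0, hs1, hrs⟩ : ∃ r s : ℤ, 0 ≤ s ∧ s < p ∧ r * p - s * q = 1 := by
        refine ⟨v - q * (-u / p), (-u) % p, Int.emod_nonneg _ (by omega),
          Int.emod_lt_of_pos _ (by omega), ?_⟩
        rw [Int.emod_def]
        linear_combination huv
      have hs2 : s ≠ 0 := by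
        rintro rfl
        have : p * r = 1 := by linear_combination hrs
        rcases Int.eq_one_or_neg_one_of_mul_eq_one this with h | h <;> omega
      have h2 := H.mul_le_mul_add (p + s).toNat q p r s hp (by omega) hrs (by omega)
      have h3 := ih r s (by omega) (by omega) ⟨p, -q, by linear_combination hrs⟩
      have hs3 : (0 : ℝ) < s := by exact_mod_cast (by omega : 0 < s)
      have hp3 : (0 : ℝ) < p := by exact_mod_cast (by omega : 0 < p)
      have h4 : (r : ℝ) * p - s * q = 1 := by exact_mod_cast hrs
      have h5 := mul_le_mul_of_nonneg_left h3 hp3.le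
      have h6 : (s : ℝ) * (q * h 1 0 + p * σ) ≤ s * h q p := by
        linear_combination h2 + h5 - h 1 0 * h4
      exact le_of_mul_le_mul_left h6 hs3

/-- The reflection `(q, p) ↦ (-q, p)` preserves convexity along the Farey graph. -/
theorem IsFareyConvex.reflect {h : ℤ → ℤ → ℝ} (H : IsFareyConvex h) :
    IsFareyConvex fun q p => h (-q) p where
  even q p := by simpa using H.even (-q) p
  subadd q p q' p' hd := by
    have := H.subadd (-q') p' (-q) p (by linear_combination hd)
    rw [add_comm (h (-q) p), add_comm q, add_comm p, neg_add]
    exact this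
  convex q p q' p' k hd := by
    have := H.convex (-q) p (k * (-q) + q') (k * p - p') k (by linear_combination hd)
    have e1 : k * (-q) - (k * (-q) + q') = -q' := by ring
    have e2 : k * p - (k * p - p') = p' := by ring
    have e3 : -(k * q - q') = k * (-q) + q' := by ring
    rw [e1, e2] at this
    rw [e3, add_comm]
    exact this

/-- A linear form that agrees with `h` at `(1, 0)` and is at most `h`, in absolute value, on the
neighbours `(n, 1)` of `(1, 0)` is at most `h` on all primitive vectors. -/
theorem IsFareyConvex.linear_le {h : ℤ → ℤ → ℝ} (H : IsFareyConvex h) {σ : ℝ}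
    (h0 : 0 ≤ h 1 0) (hσ : ∀ n : ℤ, |n * h 1 0 + σ| ≤ h n 1) (q p : ℤ) (hc : IsCoprime q p) :
    q * h 1 0 + p * σ ≤ h q p := by
  have e0 : h (-1) 0 = h 1 0 := by simpa using H.even 1 0
  rcases lt_trichotomy p 0 with hp | hp | hp
  · have := H.reflect.le_of_pos (σ := -σ) (fun n => ?_) (-p).toNat q (-p) (by omega) (by omega)
      hc.neg_right
    · have e := H.even q p
      simp only [e0, e] at this
      push_cast at this
      linarith
    · have := (neg_le_abs _).trans (hσ (-n))
      simp only [e0]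
      push_cast at this
      linarith
  · subst hp
    have hq := Int.isUnit_iff.mp (isCoprime_zero_right.mp hc)
    rcases hq with rfl | rfl
    · simp
    · simp only [e0]
      push_cast
      linarith
  · exact H.le_of_pos (fun n => (le_abs_self _).trans (hσ n)) p.toNat q p hp (by omega) hc

/-! ### Solutions of the Markov trace equations -/

/-- The value `tr [A, B] - 2` in terms of the traces `x`, `y`, `z` of `A`, `B`, `A B`, for matrices
`A`, `B` of determinant `1`. -/
def fricke (x y z : ℝ) : ℝ := x ^ 2 + y ^ 2 + z ^ 2 - x * y * z - 4

theorem two_lt_of_fricke_neg {x y z : ℝ} (hx : 2 < x) (hy : 2 < y) (h : fricke x y z < 0) :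
    2 < z := by
  unfold fricke at h
  by_contra! hz
  nlinarith [sq_nonneg (x - y), mul_nonneg (sub_nonneg.mpr hz)
    (by nlinarith : 0 ≤ x * y - 2 - z)]

/-- A positive solution of the Markov trace equations on the primitive vectors of `ℤ²`, with
`tr [A, B] < 2`. -/
structure IsMarkov (t : ℤ → ℤ → ℝ) : Prop where
  even : ∀ q p, t (-q) (-p) = t q p
  add_sub : ∀ q p q' p' : ℤ, q * p' - p * q' = 1 →
    t (q + q') (p + p') + t (q - q') (p - p') = t q p * t q' p'
  two_lt_one_zero : 2 < t 1 0
  two_lt_zero_one : 2 < t 0 1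
  fricke_neg : fricke (t 1 0) (t 0 1) (t 1 1) < 0

namespace IsMarkov

variable {t : ℤ → ℤ → ℝ}

theorem fricke_add (H : IsMarkov t) {q p q' p' : ℤ} (hd : q * p' - p * q' = 1) :
    fricke (t (q + q') (p + p')) (t q' p') (t (q + q' + q') (p + p' + p')) =
      fricke (t q p) (t q' p') (t (q + q') (p + p')) := by
  have := H.add_sub (q + q') (p + p') q' p' (by linear_combination hd)
  simp only [add_sub_cancel_right] at this
  rw [eq_sub_of_add_eq this]
  unfold fricke
  ring

theorem fricke_swap (H : IsMarkov t) {q p q' p' : ℤ} (hd : q * p' - p * q' = 1) :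
    fricke (t (-q') (-p')) (t q p) (t (-q' + q) (-p' + p)) =
      fricke (t q p) (t q' p') (t (q + q') (p + p')) := by
  have := H.add_sub q p q' p' hd
  rw [H.even, neg_add_eq_sub, neg_add_eq_sub, eq_sub_of_add_eq' this]
  unfold fricke
  ring

/-- All traces are greater than `2`, and the Fricke invariant is the same for all bases: both
properties are invariant under the generators of `SL(2, ℤ)`. -/
theorem two_lt_and_fricke (H : IsMarkov t) {q p q' p' : ℤ} (hd : q * p' - p * q' = 1) :
    2 < t q p ∧ 2 < t q' p' ∧
      fricke (t q p) (t q' p') (t (q + q') (p + p')) = fricke (t 1 0) (t 0 1) (t 1 1) := by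
  let P : SL(2, ℤ) → Prop := fun M => 2 < t (M 0 0) (M 0 1) ∧ 2 < t (M 1 0) (M 1 1) ∧
    fricke (t (M 0 0) (M 0 1)) (t (M 1 0) (M 1 1)) (t (M 0 0 + M 1 0) (M 0 1 + M 1 1)) =
      fricke (t 1 0) (t 0 1) (t 1 1)
  have hdet : ∀ M : SL(2, ℤ), M 0 0 * M 1 1 - M 0 1 * M 1 0 = 1 := fun M => by
    have := M.det_coe
    rwa [Matrix.det_fin_two] at this
  have key : ∀ g : SL(2, ℤ), ∀ M, P (g * M) ↔ P M := by
    intro g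
    have hg : g ∈ Subgroup.closure {ModularGroup.S, ModularGroup.T} := by
      rw [SpecialLinearGroup.SL2Z_generators]; trivial
    induction hg using Subgroup.closure_induction with
    | mem g hg =>
      intro M
      rcases hg with rfl | rfl
      · have h1 := H.fricke_swap (hdet M)
        simp only [P, Matrix.SpecialLinearGroup.coe_mul, ModularGroup.coe_S, Matrix.mul_apply,
          Fin.sum_univ_two, Matrix.of_apply, Matrix.cons_val', Matrix.cons_val_zero,
          Matrix.cons_val_one, Matrix.cons_val_fin_one, zero_mul, one_mul, neg_mul, zero_add,
          add_zero]
        rw [h1, H.even]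
        tauto
      · have h1 := H.fricke_add (hdet M)
        simp only [P, Matrix.SpecialLinearGroup.coe_mul, ModularGroup.coe_T, Matrix.mul_apply,
          Fin.sum_univ_two, Matrix.of_apply, Matrix.cons_val', Matrix.cons_val_zero,
          Matrix.cons_val_one, Matrix.cons_val_fin_one, zero_mul, one_mul, zero_add, h1]
        constructor
        · rintro ⟨h2, h3, h4⟩
          refine ⟨?_, h3, h4⟩
          refine two_lt_of_fricke_neg h2 h3 (lt_of_eq_of_lt ?_ (h4.trans_lt H.fricke_neg))
          unfold fricke; ring
        · rintro ⟨h2, h3, h4⟩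
          exact ⟨two_lt_of_fricke_neg h2 h3 (h4.trans_lt H.fricke_neg), h3, h4⟩
    | one => intro M; rw [one_mul]
    | mul a b _ _ ha hb => intro M; rw [mul_assoc, ha, hb]
    | inv a _ ha => intro M; rw [← ha, mul_inv_cancel_left]
  let g : SL(2, ℤ) := ⟨!![q, p; q', p'], by rw [Matrix.det_fin_two]; exact hd⟩
  have h1 := (key g 1).mpr
    (by simpa [P] using ⟨H.two_lt_one_zero, H.two_lt_zero_one⟩)
  rw [mul_one] at h1
  exact h1

theorem two_lt (H : IsMarkov t) {q p : ℤ} (hc : IsCoprime q p) : 2 < t q p := by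
  obtain ⟨u, v, huv⟩ := hc
  exact (H.two_lt_and_fricke (q := q) (p := p) (q' := -v) (p' := u)
    (by linear_combination huv)).1

end IsMarkov

/-- Half the translation length of a hyperbolic element of trace `x > 2`. -/
noncomputable def halfLength (x : ℝ) : ℝ := Real.arcosh (x / 2)

theorem halfLength_pos {x : ℝ} (hx : 2 < x) : 0 < halfLength x :=
  Real.arcosh_pos (by linarith)

theorem two_mul_cosh_halfLength {x : ℝ} (hx : 2 < x) : 2 * Real.cosh (halfLength x) = x := by
  rw [halfLength, Real.cosh_arcosh (by linarith)]
  ring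

theorem abs_le_halfLength {x y : ℝ} (hx : 2 < x) (h : Real.exp y + Real.exp (-y) ≤ x) :
    |y| ≤ halfLength x := by
  rw [← abs_of_pos (halfLength_pos hx), ← Real.cosh_le_cosh]
  have := two_mul_cosh_halfLength hx
  have := Real.cosh_eq y
  linarith

namespace IsMarkov

variable {t : ℤ → ℤ → ℝ}

theorem halfLength_add_le (H : IsMarkov t) {q p q' p' : ℤ} (hd : q * p' - p * q' = 1) :
    halfLength (t (q + q') (p + p')) ≤ halfLength (t q p) + halfLength (t q' p') := by
  obtain ⟨h1, h2, h3⟩ := H.two_lt_and_fricke hd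
  have h4 := h3.trans_lt H.fricke_neg
  have h5 := two_lt_of_fricke_neg h1 h2 h4
  have a0 := halfLength_pos h1
  have b0 := halfLength_pos h2
  have c0 := halfLength_pos h5
  rw [← two_mul_cosh_halfLength h1, ← two_mul_cosh_halfLength h2,
    ← two_mul_cosh_halfLength h5] at h4
  generalize halfLength (t q p) = a at *
  generalize halfLength (t q' p') = b at *
  generalize halfLength (t (q + q') (p + p')) = c at *
  by_contra! hlt
  have e1 : Real.cosh (a + b) < Real.cosh c := by
    rw [Real.cosh_lt_cosh, abs_of_pos (by positivity), abs_of_pos c0]; exact hlt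
  have e2 : Real.cosh (a - b) ≤ Real.cosh (a + b) := by
    rw [Real.cosh_le_cosh, abs_of_pos (a := a + b) (by positivity), abs_le]
    constructor <;> linarith
  -- the Fricke form is `4 (cosh c - cosh (a + b)) (cosh c - cosh (a - b))`
  have e3 := mul_nonneg (sub_nonneg.mpr e1.le) (sub_nonneg.mpr (e2.trans e1.le))
  rw [Real.cosh_add, Real.cosh_sub] at e3
  have e4 := Real.cosh_sq a
  have e5 := Real.cosh_sq b
  unfold fricke at h4
  have e6 : (Real.sinh a * Real.sinh b) ^ 2 = (Real.cosh a ^ 2 - 1) * (Real.cosh b ^ 2 - 1) := by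
    rw [e4, e5]; ring
  nlinarith

/-- The traces along a line `n ↦ w + n v` of vectors are `α eⁿᵃ + β e⁻ⁿᵃ`, where `2 cosh a` is the
trace at `v`. That `tr [A, B] < 2` means `α β > 1`. -/
theorem exists_eq_exp (H : IsMarkov t) {q p q' p' : ℤ} (hd : q * p' - p * q' = 1) :
    ∃ α β : ℝ, 0 < α ∧ 0 < β ∧ 1 < α * β ∧ ∀ n : ℤ, t (q' + n * q) (p' + n * p) =
      α * Real.exp (n * halfLength (t q p)) + β * Real.exp (-(n * halfLength (t q p))) := by
  obtain ⟨h1, h2, h3⟩ := H.two_lt_and_fricke hd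
  have h4 := h3.trans_lt H.fricke_neg
  have a0 := halfLength_pos h1
  have ha := two_mul_cosh_halfLength h1
  generalize halfLength (t q p) = a at *
  have hE : Real.exp a * Real.exp (-a) = 1 := by rw [← Real.exp_add]; simp
  have hE1 : Real.exp (-a) < Real.exp a := Real.exp_lt_exp.mpr (by linarith)
  have hs : Real.exp a + Real.exp (-a) = t q p := by rw [← ha, Real.cosh_eq]; ring
  have hD : Real.exp a - Real.exp (-a) ≠ 0 := by linarith
  have hD2 : 0 < (Real.exp a - Real.exp (-a)) ^ 2 := by positivity
  set E := Real.exp a with hEdef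
  set F := Real.exp (-a) with hFdef
  set t₀ := t q' p' with ht₀
  set t₁ := t (q + q') (p + p') with ht₁
  set α := (t₁ - t₀ * F) / (E - F) with hα
  set β := (E * t₀ - t₁) / (E - F) with hβ
  have hsum : α + β = t₀ := by rw [hα, hβ]; field_simp; ring
  have hsum1 : α * E + β * F = t₁ := by rw [hα, hβ]; field_simp; ring
  have hprod : 1 < α * β := by
    have : α * β = ((t₁ - t₀ * F) * (E * t₀ - t₁)) / (E - F) ^ 2 := by
      rw [hα, hβ]; field_simp
    rw [this, lt_div_iff₀ hD2]
    unfold fricke at h4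
    rw [← hs] at h4
    nlinarith
  have hα0 : 0 < α := by
    by_contra! h
    nlinarith
  have hβ0 : 0 < β := by
    by_contra! h
    nlinarith
  refine ⟨α, β, hα0, hβ0, hprod, ?_⟩
  -- both sides satisfy the recursion `f (n + 1) + f (n - 1) = t (q, p) * f n`
  have hrec : ∀ n : ℤ, t (q' + (n + 1 : ℤ) * q) (p' + (n + 1 : ℤ) * p) +
      t (q' + (n - 1 : ℤ) * q) (p' + (n - 1 : ℤ) * p) =
        t q p * t (q' + n * q) (p' + n * p) := by
    intro n
    have := H.add_sub q p (q' + n * q) (p' + n * p) (by linear_combination hd)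
    rw [← this, ← H.even (q - _)]
    congr 2 <;> ring
  have hexp : ∀ n : ℤ, Real.exp ((n + 1 : ℤ) * a) = Real.exp (n * a) * E ∧
      Real.exp ((n - 1 : ℤ) * a) = Real.exp (n * a) * F ∧
      Real.exp (-((n + 1 : ℤ) * a)) = Real.exp (-(n * a)) * F ∧
      Real.exp (-((n - 1 : ℤ) * a)) = Real.exp (-(n * a)) * E := by
    intro n
    simp only [hEdef, hFdef, ← Real.exp_add]
    push_cast
    refine ⟨?_, ?_, ?_, ?_⟩ <;> congr 1 <;> ring
  set g : ℤ → ℝ := fun n => α * Real.exp (n * a) + β * Real.exp (-(n * a)) with hg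
  have hgrec : ∀ n : ℤ, g (n + 1) + g (n - 1) = t q p * g n := by
    intro n
    obtain ⟨e1, e2, e3, e4⟩ := hexp n
    simp only [hg, e1, e2, e3, e4, ← hs]
    ring
  have hpair : ∀ n : ℤ, t (q' + n * q) (p' + n * p) = g n ∧
      t (q' + (n + 1 : ℤ) * q) (p' + (n + 1 : ℤ) * p) = g (n + 1) := by
    intro n
    induction n using Int.induction_on with
    | zero =>
      constructor
      · simp [hg, hsum, ht₀]
      · have : g 1 = α * E + β * F := by simp [hg, hEdef, hFdef]
        rw [zero_add, this, hsum1, ht₁]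
        congr 1 <;> ring
    | succ n ih =>
      refine ⟨ih.2, ?_⟩
      have e1 := hrec (n + 1)
      have e2 := hgrec (n + 1)
      simp only [add_sub_cancel_right] at e1 e2
      rw [ih.1, ih.2] at e1
      linarith
    | pred n ih =>
      have e1 := hrec (-n)
      have e2 := hgrec (-n)
      rw [ih.1, ih.2] at e1
      rw [sub_add_cancel]
      exact ⟨by linarith, ih.1⟩
  exact fun n => (hpair n).1

/-- The lengths along the line `n ↦ w + n v` have two distinct affine minorants of slope the length
of `v`: these are the asymptotes of the length at both ends of the line. -/
theorem exists_asymptotes (H : IsMarkov t) {q p q' p' : ℤ} (hd : q * p' - p * q' = 1) :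
    ∃ σ τ : ℝ, σ ≠ τ ∧ ∀ n : ℤ,
      |n * halfLength (t q p) + σ| ≤ halfLength (t (q' + n * q) (p' + n * p)) ∧
      |n * halfLength (t q p) + τ| ≤ halfLength (t (q' + n * q) (p' + n * p)) := by
  obtain ⟨α, β, hα, hβ, hαβ, h⟩ := H.exists_eq_exp hd
  refine ⟨Real.log α, -Real.log β, ?_, fun n => ?_⟩
  · have := Real.log_pos hαβ
    rw [Real.log_mul hα.ne' hβ.ne'] at this
    intro h
    linarith
  have h2 : 2 < t (q' + n * q) (p' + n * p) := by
    refine H.two_lt ⟨-p, q, by linear_combination hd⟩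
  have h3 := h n
  have e1 := Real.exp_pos (n * halfLength (t q p))
  have e2 := Real.exp_pos (-(n * halfLength (t q p)))
  constructor
  · apply abs_le_halfLength h2
    rw [neg_add, Real.exp_add, Real.exp_add, Real.exp_neg (Real.log α), Real.exp_log hα, h3]
    have : α⁻¹ ≤ β := by
      rw [inv_le_iff_one_le_mul₀' hα]; exact hαβ.le
    nlinarith
  · apply abs_le_halfLength h2
    rw [neg_add, neg_neg, Real.exp_add, Real.exp_add, Real.exp_neg (Real.log β),
      Real.exp_log hβ, h3]
    have : β⁻¹ ≤ α := by
      rw [inv_le_iff_one_le_mul₀ hβ]; exact hαβ.le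
    nlinarith

theorem isFareyConvex (H : IsMarkov t) : IsFareyConvex fun q p => halfLength (t q p) where
  even q p := by simp only [H.even]
  subadd q p q' p' hd := H.halfLength_add_le hd
  convex q p q' p' k hd := by
    obtain ⟨σ, τ, -, h⟩ := H.exists_asymptotes hd
    have h1 := (le_abs_self _).trans (h 0).1
    have h2 := (neg_le_abs _).trans (h (-k)).1
    have e : t (q' + -k * q) (p' + -k * p) = t (k * q - q') (k * p - p') := by
      rw [← H.even]
      congr 1 <;> ring
    rw [e] at h2
    simp only [Int.cast_zero, zero_mul, zero_add, add_zero] at h1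
    push_cast at h2
    linarith

end IsMarkov

/-- Convexity along the Farey graph is preserved by changes of basis of `ℤ²`. -/
theorem IsFareyConvex.comp {h : ℤ → ℤ → ℝ} (H : IsFareyConvex h) {a b c d : ℤ}
    (hd : a * d - b * c = 1) :
    IsFareyConvex fun q p => h (q * a + p * c) (q * b + p * d) where
  even q p := by
    rw [← H.even]
    congr 1 <;> ring
  subadd q p q' p' hq := by
    have := H.subadd (q * a + p * c) (q * b + p * d) (q' * a + p' * c) (q' * b + p' * d)
      (by linear_combination (a * d - b * c) * hq + hd)
    refine le_of_eq_of_le ?_ this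
    congr 1 <;> ring
  convex q p q' p' k hq := by
    have := H.convex (q * a + p * c) (q * b + p * d) (q' * a + p' * c) (q' * b + p' * d) k
      (by linear_combination (a * d - b * c) * hq + hd)
    refine this.trans (le_of_eq ?_)
    congr 2 <;> ring

/-- At each primitive vector, the length has two distinct supporting linear forms. -/
theorem IsMarkov.exists_supporting {t : ℤ → ℤ → ℝ} (H : IsMarkov t) {q p : ℤ}
    (hc : IsCoprime q p) :
    ∃ f g f' g' : ℝ, q * g - p * f ≠ q * g' - p * f' ∧
      f * q + g * p = halfLength (t q p) ∧ f' * q + g' * p = halfLength (t q p) ∧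
      ∀ m n : ℤ, IsCoprime m n →
        f * m + g * n ≤ halfLength (t m n) ∧ f' * m + g' * n ≤ halfLength (t m n) := by
  have ha := halfLength_pos (H.two_lt hc)
  obtain ⟨u, v, huv⟩ := hc
  have hd : q * u - p * (-v) = 1 := by linear_combination huv
  have hdR : (q : ℝ) * u + p * v = 1 := by exact_mod_cast (by linear_combination huv)
  have H' := H.isFareyConvex.comp hd
  -- `(m, n) = (m u + n v) (q, p) + (q n - p m) (-v, u)`
  have key : ∀ σ : ℝ, (∀ n : ℤ,
      |n * halfLength (t q p) + σ| ≤ halfLength (t (-v + n * q) (u + n * p))) →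
      ∀ m n : ℤ, IsCoprime m n → (u * halfLength (t q p) - p * σ) * m +
        (v * halfLength (t q p) + q * σ) * n ≤ halfLength (t m n) := by
    intro σ hσ m n hmn
    have e : halfLength (t q p) = halfLength (t (1 * q + 0 * -v) (1 * p + 0 * u)) := by simp
    obtain ⟨x, y, hxy⟩ := hmn
    have := H'.linear_le (σ := σ) ?_ ?_ (m * u + n * v) (q * n - p * m) ?_
    · refine le_trans (le_of_eq ?_) (this.trans (le_of_eq ?_))
      · rw [← e]
        push_cast
        ring
      · congr 2
        · linear_combination m * hd
        · linear_combination n * hd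
    · rw [← e]; exact ha.le
    · intro k
      rw [← e]
      refine (hσ k).trans (le_of_eq ?_)
      congr 2 <;> ring
    · exact ⟨x * q + y * p, y * u - x * v, by linear_combination hxy + (x * m + y * n) * hd⟩
  obtain ⟨σ, τ, hστ, hb⟩ := H.exists_asymptotes hd
  refine ⟨_, _, _, _, fun h => hστ ?_, ?_, ?_, fun m n hmn => ⟨key σ (fun n => (hb n).1) m n hmn,
    key τ (fun n => (hb n).2) m n hmn⟩⟩
  · have h0 : (0 : ℝ) < q ^ 2 + p ^ 2 := by
      by_contra! h0
      have hq : (q : ℝ) = 0 := by nlinarith [sq_nonneg (q : ℝ), sq_nonneg (p : ℝ)]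
      have hp : (p : ℝ) = 0 := by nlinarith [sq_nonneg (q : ℝ), sq_nonneg (p : ℝ)]
      simp [hq, hp] at hdR
    refine mul_left_cancel₀ h0.ne' ?_
    linear_combination h
  · linear_combination halfLength (t q p) * hdR
  · linear_combination halfLength (t q p) * hdR

/-! ### Convex homogeneous functions with prescribed values on primitive vectors -/

/-- The linear forms `(u, v) ↦ f₁ u + f₂ v` that are at most `h` on the primitive vectors, as a set
of pairs `(f₁, f₂)`. -/
def dualBall (h : ℤ → ℤ → ℝ) : Set (ℝ × ℝ) :=
  {f | ∀ q p : ℤ, IsCoprime q p → f.1 * q + f.2 * p ≤ h q p}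

/-- The largest convex homogeneous function on `ℝ²` that is at most `h` on the primitive vectors:
the support function of `dualBall h`. -/
noncomputable def stableNorm (h : ℤ → ℤ → ℝ) (v : ℝ × ℝ) : ℝ :=
  ⨆ f : dualBall h, f.1.1 * v.1 + f.1.2 * v.2

/-- A positive even function on the primitive vectors that has two distinct supporting linear forms
at each of them. -/
structure IsSharplySupported (h : ℤ → ℤ → ℝ) : Prop where
  even : ∀ q p, h (-q) (-p) = h q p
  pos : ∀ q p, IsCoprime q p → 0 < h q p
  supporting : ∀ q p : ℤ, IsCoprime q p → ∃ f ∈ dualBall h, ∃ g ∈ dualBall h,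
    q * f.2 - p * f.1 ≠ q * g.2 - p * g.1 ∧
      f.1 * q + f.2 * p = h q p ∧ g.1 * q + g.2 * p = h q p

namespace IsSharplySupported

variable {h : ℤ → ℤ → ℝ}

theorem neg_mem (H : IsSharplySupported h) {f : ℝ × ℝ} (hf : f ∈ dualBall h) :
    -f ∈ dualBall h := by
  intro q p hc
  have := hf (-q) (-p) hc.neg_neg
  rw [H.even] at this
  push_cast at this
  simpa using this

theorem zero_mem (H : IsSharplySupported h) : (0 : ℝ × ℝ) ∈ dualBall h := by
  intro q p hc
  simpa using (H.pos q p hc).le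

theorem le_bound (H : IsSharplySupported h) {f : ℝ × ℝ} (hf : f ∈ dualBall h) (v : ℝ × ℝ) :
    f.1 * v.1 + f.2 * v.2 ≤ h 1 0 * |v.1| + h 0 1 * |v.2| := by
  have h1 := hf 1 0 isCoprime_one_left
  have h2 := hf 0 1 isCoprime_one_right
  have h3 := H.neg_mem hf 1 0 isCoprime_one_left
  have h4 := H.neg_mem hf 0 1 isCoprime_one_right
  simp only [Int.cast_one, Int.cast_zero, mul_one, mul_zero, add_zero, zero_add, Prod.fst_neg,
    Prod.snd_neg] at h1 h2 h3 h4
  have h5 : |f.1| ≤ h 1 0 := abs_le.mpr ⟨by linarith, h1⟩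
  have h6 : |f.2| ≤ h 0 1 := abs_le.mpr ⟨by linarith, h2⟩
  have h7 := (le_abs_self _).trans (abs_mul f.1 v.1).le
  have h8 := (le_abs_self _).trans (abs_mul f.2 v.2).le
  have h9 := mul_le_mul_of_nonneg_right h5 (abs_nonneg v.1)
  have h10 := mul_le_mul_of_nonneg_right h6 (abs_nonneg v.2)
  linarith

theorem le_stableNorm (H : IsSharplySupported h) {f : ℝ × ℝ} (hf : f ∈ dualBall h) (v : ℝ × ℝ) :
    f.1 * v.1 + f.2 * v.2 ≤ stableNorm h v := by
  refine le_ciSup (f := fun f : dualBall h => f.1.1 * v.1 + f.1.2 * v.2) ?_ ⟨f, hf⟩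
  exact ⟨_, by rintro _ ⟨g, rfl⟩; exact H.le_bound g.2 v⟩

theorem stableNorm_le (H : IsSharplySupported h) {v : ℝ × ℝ} {M : ℝ}
    (hM : ∀ f ∈ dualBall h, f.1 * v.1 + f.2 * v.2 ≤ M) : stableNorm h v ≤ M :=
  haveI : Nonempty (dualBall h) := ⟨⟨0, H.zero_mem⟩⟩
  ciSup_le fun f => hM f.1 f.2

theorem stableNorm_nonneg (H : IsSharplySupported h) (v : ℝ × ℝ) : 0 ≤ stableNorm h v := by
  simpa using H.le_stableNorm H.zero_mem v

theorem stableNorm_apply (H : IsSharplySupported h) {q p : ℤ} (hc : IsCoprime q p) :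
    stableNorm h (q, p) = h q p := by
  obtain ⟨f, hf, -, -, -, hfe, -⟩ := H.supporting q p hc
  exact le_antisymm (H.stableNorm_le fun g hg => hg q p hc) (hfe ▸ H.le_stableNorm hf (q, p))

theorem stableNorm_neg (H : IsSharplySupported h) (v : ℝ × ℝ) :
    stableNorm h (-v) = stableNorm h v := by
  have key : ∀ w : ℝ × ℝ, stableNorm h (-w) ≤ stableNorm h w := fun w =>
    H.stableNorm_le fun f hf => by
      have := H.le_stableNorm (H.neg_mem hf) w
      simp only [Prod.fst_neg, Prod.snd_neg] at this ⊢
      linarith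
  exact le_antisymm (key v) (by simpa using key (-v))

theorem stableNorm_smul_of_nonneg (H : IsSharplySupported h) {s : ℝ} (hs : 0 ≤ s) (v : ℝ × ℝ) :
    stableNorm h (s • v) = s * stableNorm h v := by
  have key : ∀ {r : ℝ}, 0 ≤ r → ∀ w : ℝ × ℝ, stableNorm h (r • w) ≤ r * stableNorm h w :=
    fun {r} hr w => H.stableNorm_le fun f hf => by
      have := mul_le_mul_of_nonneg_left (H.le_stableNorm hf w) hr
      simp only [Prod.smul_fst, Prod.smul_snd, smul_eq_mul]
      linarith
  refine le_antisymm (key hs v) ?_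
  rcases hs.eq_or_lt with rfl | hs
  · simpa using H.stableNorm_nonneg _
  · have := key (inv_nonneg.mpr hs.le) (s • v)
    rw [inv_smul_smul₀ hs.ne', ← div_eq_inv_mul, le_div_iff₀ hs] at this
    linarith

theorem stableNorm_smul (H : IsSharplySupported h) (s : ℝ) (v : ℝ × ℝ) :
    stableNorm h (s • v) = |s| * stableNorm h v := by
  rcases le_total 0 s with hs | hs
  · rw [abs_of_nonneg hs, H.stableNorm_smul_of_nonneg hs]
  · rw [abs_of_nonpos hs, ← H.stableNorm_smul_of_nonneg (neg_nonneg.mpr hs), neg_smul,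
      H.stableNorm_neg]

theorem convexOn_stableNorm (H : IsSharplySupported h) : ConvexOn ℝ Set.univ (stableNorm h) := by
  refine ⟨convex_univ, fun v _ w _ a b ha hb _ => H.stableNorm_le fun f hf => ?_⟩
  have h1 := mul_le_mul_of_nonneg_left (H.le_stableNorm hf v) ha
  have h2 := mul_le_mul_of_nonneg_left (H.le_stableNorm hf w) hb
  simp only [Prod.fst_add, Prod.snd_add, Prod.smul_fst, Prod.smul_snd, smul_eq_mul]
  linarith

theorem continuous_stableNorm (H : IsSharplySupported h) : Continuous (stableNorm h) :=
  H.convexOn_stableNorm.locallyLipschitz.continuous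

end IsSharplySupported

/-- Every pair of rational numbers is a multiple of a primitive vector. -/
theorem exists_eq_smul_coprime (r s : ℚ) : ∃ (c : ℝ) (q p : ℤ), IsCoprime q p ∧
    ((r : ℝ), (s : ℝ)) = c • ((q : ℝ), (p : ℝ)) := by
  by_cases h0 : r.num * s.den = 0 ∧ s.num * r.den = 0
  · refine ⟨0, 1, 0, isCoprime_one_left, ?_⟩
    have h1 : r = 0 := by simpa using h0.1
    have h2 : s = 0 := by simpa using h0.2
    simp [h1, h2]
  · have hg : 0 < Int.gcd (r.num * s.den) (s.num * r.den) := by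
      rw [Int.gcd_pos_iff]
      tauto
    obtain ⟨q, p, hqp, hq, hp⟩ := Int.exists_gcd_one hg
    refine ⟨(Int.gcd (r.num * s.den) (s.num * r.den) : ℝ) / (r.den * s.den), q, p,
      Int.isCoprime_iff_gcd_eq_one.mpr hqp, ?_⟩
    have hr : (r.den : ℝ) ≠ 0 := by exact_mod_cast r.den_nz
    have hs : (s.den : ℝ) ≠ 0 := by exact_mod_cast s.den_nz
    have hq' : (r.num : ℝ) * s.den = q * Int.gcd (r.num * s.den) (s.num * r.den) := by
      exact_mod_cast hq
    have hp' : (s.num : ℝ) * r.den = p * Int.gcd (r.num * s.den) (s.num * r.den) := by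
      exact_mod_cast hp
    ext
    · simp only [Prod.smul_mk, smul_eq_mul]
      rw [Rat.cast_def]
      field_simp
      linarith
    · simp only [Prod.smul_mk, smul_eq_mul]
      rw [Rat.cast_def]
      field_simp
      linarith

/-- The multiples of primitive vectors contain `ℚ²`, so that the values on primitive vectors
determine a continuous homogeneous function. -/
theorem IsLengthExtension.ext {ρ : F₂ →* PSL(2, ℝ)} {a : ℝ} {L L' : ℝ × ℝ → ℝ}
    (h : IsLengthExtension ρ a L) (h' : IsLengthExtension ρ a L') : L' = L := by
  have hd : DenseRange (Prod.map ((↑) : ℚ → ℝ) ((↑) : ℚ → ℝ)) :=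
    Rat.denseRange_cast.prodMap Rat.denseRange_cast
  refine hd.equalizer h'.continuous h.continuous ?_
  funext ⟨r, s⟩
  obtain ⟨c, q, p, hc, e⟩ := exists_eq_smul_coprime r s
  simp only [Function.comp_apply, Prod.map_apply, e, h.homogeneous, h'.homogeneous,
    h.apply_coprime q p hc, h'.apply_coprime q p hc]

namespace IsSharplySupported

variable {h : ℤ → ℤ → ℝ}

/-- The plane `z = f₁ u + f₂ v` attached to a supporting linear form at `(q, p)`. -/
theorem isSupportingPlaneAlong (H : IsSharplySupported h) {f : ℝ × ℝ} (hf : f ∈ dualBall h)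
    {q p : ℤ} (hc : IsCoprime q p) (he : f.1 * q + f.2 * p = h q p) :
    IsSupportingPlaneAlong (regionAbove (stableNorm h)) (graphRay (stableNorm h) q p)
      {w | w.2 - (f.1 * w.1.1 + f.2 * w.1.2) = 0} := by
  refine ⟨⟨LinearMap.snd ℝ (ℝ × ℝ) ℝ - (f.1 • (LinearMap.fst ℝ ℝ ℝ ∘ₗ LinearMap.fst ℝ (ℝ × ℝ) ℝ) +
    f.2 • (LinearMap.snd ℝ ℝ ℝ ∘ₗ LinearMap.fst ℝ (ℝ × ℝ) ℝ)), 0, ?_, ?_, ?_⟩, ?_⟩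
  · intro h0
    have := LinearMap.congr_fun h0 ((0, 0), 1)
    simp at this
  · ext w; simp
  · intro w hw
    have h1 := H.le_stableNorm hf w.1
    have h2 : stableNorm h w.1 ≤ w.2 := hw
    simp only [LinearMap.sub_apply, LinearMap.add_apply, LinearMap.smul_apply,
      LinearMap.comp_apply, LinearMap.fst_apply, LinearMap.snd_apply, smul_eq_mul]
    linarith
  · rintro w ⟨s, hs, rfl⟩
    refine ⟨le_refl (stableNorm h _), ?_⟩
    have : stableNorm h (s * q, s * p) = s * h q p := by
      rw [← H.stableNorm_apply hc, ← H.stableNorm_smul_of_nonneg hs]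
      simp
    simp only [Set.mem_ofPred_eq, this, ← he]
    ring

theorem nontrivial_supportingPlanes (H : IsSharplySupported h) {q p : ℤ} (hc : IsCoprime q p) :
    {P | IsSupportingPlaneAlong (regionAbove (stableNorm h))
      (graphRay (stableNorm h) q p) P}.Nontrivial := by
  obtain ⟨f, hf, g, hg, hne, hfe, hge⟩ := H.supporting q p hc
  refine ⟨_, H.isSupportingPlaneAlong hf hc hfe, _, H.isSupportingPlaneAlong hg hc hge, ?_⟩
  intro h0
  -- the two planes differ above `(-p, q)`
  have : (((-p, q), q * f.2 - p * f.1) : (ℝ × ℝ) × ℝ) ∈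
      {w : (ℝ × ℝ) × ℝ | w.2 - (g.1 * w.1.1 + g.2 * w.1.2) = 0} := by
    rw [← h0]
    simp only [Set.mem_ofPred_eq]
    ring
  simp only [Set.mem_ofPred_eq] at this
  exact hne (by linarith)

/-- The two supporting planes meet the region above the graph only along the ray, which is
therefore extremal. -/
theorem isExtreme_graphRay (H : IsSharplySupported h) {q p : ℤ} (hc : IsCoprime q p) :
    IsExtreme ℝ (regionAbove (stableNorm h)) (graphRay (stableNorm h) q p) := by
  obtain ⟨f, hf, g, hg, hne, hfe, hge⟩ := H.supporting q p hc
  have sub := fun {k : ℝ × ℝ} (hk : k ∈ dualBall h) he => (H.isSupportingPlaneAlong hk hc he).subset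
  refine ⟨fun w hw => (sub hf hfe hw).1, fun {w₁} hw₁ {w₂} hw₂ w hw hseg => ?_⟩
  -- a supporting plane through `w` contains both endpoints of the segment
  have key : ∀ k ∈ dualBall h, k.1 * q + k.2 * p = h q p →
      w₁.2 = k.1 * w₁.1.1 + k.2 * w₁.1.2 := by
    intro k hk he
    have h0 := (sub hk he hw).2
    obtain ⟨a, b, ha, hb, hab, rfl⟩ := hseg
    have h1 := (H.le_stableNorm hk w₁.1).trans hw₁
    have h2 := (H.le_stableNorm hk w₂.1).trans hw₂
    simp only [Set.mem_ofPred_eq, Prod.fst_add, Prod.snd_add, Prod.smul_fst, Prod.smul_snd,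
      smul_eq_mul] at h0
    have h3 := mul_le_mul_of_nonneg_left h2 hb.le
    refine le_antisymm (le_of_mul_le_mul_left ?_ ha) h1
    linarith
  obtain ⟨⟨u, v⟩, z⟩ := w₁
  have h1 := key f hf hfe
  have h2 := key g hg hge
  have hu : stableNorm h (u, v) ≤ z := hw₁
  have hpos := H.pos q p hc
  simp only at h1 h2
  have h3 : (q * v - p * u) * ((q * f.2 - p * f.1) - (q * g.2 - p * g.1)) = 0 := by
    linear_combination (-(q ^ 2 : ℝ) - p ^ 2) * h1 + ((q : ℝ) ^ 2 + p ^ 2) * h2 -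
      (u * q + v * p) * (hfe - hge)
  have h4 : (q : ℝ) * v = p * u :=
    sub_eq_zero.mp ((mul_eq_zero.mp h3).resolve_right (sub_ne_zero.mpr hne))
  obtain ⟨m, n, hmn⟩ := hc
  have hmnR : (m : ℝ) * q + n * p = 1 := by exact_mod_cast hmn
  have hc : IsCoprime q p := ⟨m, n, hmn⟩
  have e1 : u = (m * u + n * v) * q := by linear_combination -u * hmnR - n * h4
  have e2 : v = (m * u + n * v) * p := by linear_combination -v * hmnR + m * h4
  have hz : z = (m * u + n * v) * h q p := by
    rw [h1, ← hfe]
    linear_combination f.1 * e1 + f.2 * e2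
  have ht : 0 ≤ m * u + n * v := by
    have := (H.stableNorm_nonneg _).trans hu
    rw [hz] at this
    exact nonneg_of_mul_nonneg_left this hpos
  refine ⟨m * u + n * v, ht, ?_⟩
  rw [← e1, ← e2]
  ext
  · rfl
  · rfl
  · have : ((u, v) : ℝ × ℝ) = (m * u + n * v) • ((q : ℝ), (p : ℝ)) := by
      rw [Prod.smul_mk, smul_eq_mul, smul_eq_mul, ← e1, ← e2]
    rw [this, H.stableNorm_smul_of_nonneg ht, H.stableNorm_apply hc, hz]

end IsSharplySupported

/-- Lengths relative to a positive unit `a` are sharply supported. -/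
theorem IsMarkov.isSharplySupported {t : ℤ → ℤ → ℝ} (H : IsMarkov t) {a : ℝ} (ha : 0 < a) :
    IsSharplySupported fun q p => halfLength (t q p) / a where
  even q p := by simp only [H.even]
  pos q p hc := div_pos (halfLength_pos (H.two_lt hc)) ha
  supporting q p hc := by
    obtain ⟨f, g, f', g', hne, he, he', hle⟩ := H.exists_supporting hc
    refine ⟨(f / a, g / a), fun m n hmn => ?_, (f' / a, g' / a), fun m n hmn => ?_, ?_, ?_, ?_⟩
    · have := div_le_div_of_nonneg_right (hle m n hmn).1 ha.le
      refine le_of_eq_of_le ?_ this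
      ring
    · have := div_le_div_of_nonneg_right (hle m n hmn).2 ha.le
      refine le_of_eq_of_le ?_ this
      ring
    · intro h0
      apply hne
      field_simp at h0
      linarith
    · rw [← he]; ring
    · rw [← he']; ring

/-! ### Words of straight lines and their traces -/

/-- Up to its intermediate vertex, the path of edges `(n₁, m₁)`, `(n₂, m₂)` has the same integer
parts as the straight line with the same ends. -/
theorem mul_ediv_add_eq {n₁ n₂ m₁ m₂ i : ℤ} (h₁ : 0 < n₁) (h₂ : 0 < n₂)
    (hd : n₁ * m₂ - m₁ * n₂ = 1) (hi : 0 ≤ i) (hin : i ≤ n₁) :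
    i * (m₁ + m₂) / (n₁ + n₂) = i * m₁ / n₁ := by
  have e := Int.mul_ediv_add_emod (i * m₁) n₁
  have r0 := Int.emod_nonneg (i * m₁) h₁.ne'
  have r1 := Int.emod_lt_of_pos (i * m₁) h₁
  set k := i * m₁ / n₁
  set r := i * m₁ % n₁
  have key : n₁ * (i * (m₁ + m₂)) = n₁ * (k * (n₁ + n₂)) + ((n₁ + n₂) * r + i) := by
    linear_combination i * hd - (n₁ + n₂) * e
  apply le_antisymm
  · rw [← Int.lt_add_one_iff, Int.ediv_lt_iff_lt_mul (by omega)]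
    refine lt_of_mul_lt_mul_left ?_ h₁.le
    rw [key]
    nlinarith
  · rw [Int.le_ediv_iff_mul_le (by omega)]
    refine le_of_mul_le_mul_left ?_ h₁
    rw [key]
    nlinarith

/-- From its intermediate vertex on, the path of edges `(n₁, m₁)`, `(n₂, m₂)` has the same integer
parts as the straight line with the same ends. -/
theorem add_mul_ediv_add_eq {n₁ n₂ m₁ m₂ i : ℤ} (h₁ : 0 < n₁) (h₂ : 0 < n₂)
    (hd : n₁ * m₂ - m₁ * n₂ = 1) (hi : 0 ≤ i) (hin : i ≤ n₂) :
    (n₁ + i) * (m₁ + m₂) / (n₁ + n₂) = m₁ + i * m₂ / n₂ := by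
  have e := Int.mul_ediv_add_emod (i * m₂) n₂
  have r0 := Int.emod_nonneg (i * m₂) h₂.ne'
  have r1 := Int.emod_lt_of_pos (i * m₂) h₂
  set k := i * m₂ / n₂
  set r := i * m₂ % n₂
  have key : n₂ * ((n₁ + i) * (m₁ + m₂)) =
      n₂ * ((m₁ + k) * (n₁ + n₂)) + ((n₁ + n₂) * r + (n₂ - i)) := by
    linear_combination (n₂ - i) * hd - (n₁ + n₂) * e
  apply le_antisymm
  · rw [← Int.lt_add_one_iff, Int.ediv_lt_iff_lt_mul (by omega)]
    refine lt_of_mul_lt_mul_left ?_ h₂.le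
    rw [key]
    nlinarith
  · rw [Int.le_ediv_iff_mul_le (by omega)]
    refine le_of_mul_le_mul_left ?_ h₂
    rw [key]
    nlinarith

/-- The standard factorization of Christoffel words: the triangle with edges the primitive vectors
`(n₁, m₁)` and `(n₂, m₂)` of a basis contains no lattice points other than its vertices, so that the
line of direction `(n₁ + n₂, m₁ + m₂)` can be pushed onto the other two edges. -/
theorem lineWord_add {n₁ n₂ : ℕ} {m₁ m₂ : ℤ} (h₁ : 0 < n₁) (h₂ : 0 < n₂)
    (hd : n₁ * m₂ - m₁ * n₂ = 1) :
    lineWord (n₁ + n₂) (m₁ + m₂) = lineWord n₁ m₁ * lineWord n₂ m₂ := by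
  have h₁' : (0 : ℤ) < n₁ := by exact_mod_cast h₁
  have h₂' : (0 : ℤ) < n₂ := by exact_mod_cast h₂
  unfold lineWord
  rw [List.range_add, List.map_append, List.prod_append, List.map_map]
  congr 2
  · refine List.map_congr_left fun i hi => ?_
    have hi := List.mem_range.mp hi
    push_cast
    rw [mul_ediv_add_eq h₁' h₂' hd (by omega) (by omega),
      mul_ediv_add_eq h₁' h₂' hd (by omega) (by omega)]
  · refine List.map_congr_left fun i hi => ?_
    have hi := List.mem_range.mp hi
    simp only [Function.comp_apply]
    push_cast
    rw [add_assoc, add_mul_ediv_add_eq h₁' h₂' hd (by omega) (by omega),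
      add_mul_ediv_add_eq h₁' h₂' hd (by omega) (by omega), add_sub_add_left_eq_sub]

theorem lineWord_one (m : ℤ) : lineWord 1 m = x * y ^ m := by
  simp [lineWord]

theorem slopeCurve_neg_neg {q p : ℤ} : slopeCurve (-q) (-p) = slopeCurve q p := by
  simp [slopeCurve]

theorem slopeCurve_natCast {n : ℕ} (hn : 0 < n) (m : ℤ) : slopeCurve n m = lineWord n m := by
  simp [slopeCurve, hn.ne', Int.sign_natCast_of_ne_zero hn.ne']

theorem slopeCurve_zero (p : ℤ) : slopeCurve 0 p = y := by
  simp [slopeCurve]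

theorem slopeCurve_one (p : ℤ) : slopeCurve 1 p = x * y ^ p := by
  rw [← lineWord_one, ← slopeCurve_natCast one_pos, Nat.cast_one]

theorem slopeCurve_add {q p q' p' : ℤ} (hq : 0 < q) (hq' : 0 ≤ q') (hd : q * p' - p * q' = 1) :
    slopeCurve (q + q') (p + p') = slopeCurve q p * slopeCurve q' p' := by
  rcases hq'.eq_or_lt with rfl | hq'
  · have h1 : q * p' = 1 := by linear_combination hd
    have h2 : q = 1 := by
      rcases Int.eq_one_or_neg_one_of_mul_eq_one h1 with h | h <;> omega
    subst h2
    have h3 : p' = 1 := by linear_combination h1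
    subst h3
    rw [add_zero, slopeCurve_one, slopeCurve_one, slopeCurve_zero, zpow_add_one, mul_assoc]
  · lift q to ℕ using hq.le
    lift q' to ℕ using hq'.le
    have h1 : 0 < q := by exact_mod_cast hq
    have h2 : 0 < q' := by exact_mod_cast hq'
    rw [← Nat.cast_add, slopeCurve_natCast (by omega), slopeCurve_natCast h1,
      slopeCurve_natCast h2, lineWord_add h1 h2 hd]

/-- The trace of a matrix of determinant `1`. -/
def tr (A : SL(2, ℝ)) : ℝ := A 0 0 + A 1 1

theorem tr_mul_add_tr_mul_inv (A B : SL(2, ℝ)) : tr (A * B) + tr (A * B⁻¹) = tr A * tr B := by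
  simp only [tr, Matrix.SpecialLinearGroup.coe_mul, Matrix.SpecialLinearGroup.coe_inv,
    Matrix.adjugate_fin_two, Matrix.mul_apply, Fin.sum_univ_two, Matrix.of_apply,
    Matrix.cons_val', Matrix.cons_val_zero, Matrix.cons_val_one, Matrix.cons_val_fin_one]
  ring

theorem tr_inv (A : SL(2, ℝ)) : tr A⁻¹ = tr A := by
  simp [tr, Matrix.SpecialLinearGroup.coe_inv, Matrix.adjugate_fin_two, add_comm]

theorem tr_mul_comm (A B : SL(2, ℝ)) : tr (A * B) = tr (B * A) := by
  simp only [tr, Matrix.SpecialLinearGroup.coe_mul, Matrix.mul_apply, Fin.sum_univ_two]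
  ring

/-- The trace of the simple closed curve of slope `p / q` in a linear representation. -/
def slopeTrace (r : F₂ →* SL(2, ℝ)) (q p : ℤ) : ℝ := tr (r (slopeCurve q p))

theorem slopeTrace_neg_neg (r : F₂ →* SL(2, ℝ)) (q p : ℤ) :
    slopeTrace r (-q) (-p) = slopeTrace r q p := by
  rw [slopeTrace, slopeCurve_neg_neg, slopeTrace]

theorem slopeTrace_add_sub_of_nonneg (r : F₂ →* SL(2, ℝ)) {q p q' p' : ℤ} (hq : 0 < q)
    (hq' : 0 ≤ q') (hd : q * p' - p * q' = 1) :
    slopeTrace r (q + q') (p + p') + slopeTrace r (q - q') (p - p') =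
      slopeTrace r q p * slopeTrace r q' p' := by
  have h1 : slopeTrace r (q + q') (p + p') =
      tr (r (slopeCurve q p) * r (slopeCurve q' p')) := by
    rw [slopeTrace, slopeCurve_add hq hq' hd, map_mul]
  have h2 : slopeTrace r (q - q') (p - p') =
      tr (r (slopeCurve q p) * (r (slopeCurve q' p'))⁻¹) := by
    rcases lt_or_ge q' q with hlt | hge
    · have := slopeCurve_add (q := q - q') (p := p - p') (q' := q') (p' := p') (by omega) hq'
        (by linear_combination hd)
      rw [sub_add_cancel, sub_add_cancel] at this
      rw [slopeTrace, this, map_mul, mul_inv_cancel_right]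
    · have := slopeCurve_add (q := q) (p := p) (q' := q' - q) (p' := p' - p) hq (by omega)
        (by linear_combination hd)
      rw [add_sub_cancel, add_sub_cancel] at this
      rw [← slopeTrace_neg_neg, neg_sub, neg_sub, slopeTrace, this, map_mul, mul_inv_rev,
        tr_mul_comm, inv_mul_cancel_right, tr_inv]
  rw [h1, h2, tr_mul_add_tr_mul_inv]
  rfl

theorem slopeTrace_add_sub (r : F₂ →* SL(2, ℝ)) {q p q' p' : ℤ} (hd : q * p' - p * q' = 1) :
    slopeTrace r (q + q') (p + p') + slopeTrace r (q - q') (p - p') =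
      slopeTrace r q p * slopeTrace r q' p' := by
  have e : slopeTrace r (q - q') (p - p') = slopeTrace r (q' - q) (p' - p) := by
    rw [← slopeTrace_neg_neg, neg_sub, neg_sub]
  have e' : slopeTrace r (q + q') (p + p') = slopeTrace r (-q - q') (-p - p') := by
    rw [← slopeTrace_neg_neg, neg_add', neg_add']
  -- one of the bases `(u, u')`, `(-u, -u')`, `(-u', u)`, `(u', -u)` lies in the right half-plane
  rcases lt_or_ge 0 q with hq | hq
  · rcases le_or_gt 0 q' with hq' | hq'
    · exact slopeTrace_add_sub_of_nonneg r hq hq' hd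
    · have := slopeTrace_add_sub_of_nonneg r (q := -q') (p := -p') (q' := q) (p' := p)
        (by omega) hq.le (by linear_combination hd)
      rw [slopeTrace_neg_neg, neg_add_eq_sub, neg_add_eq_sub, ← neg_add', ← neg_add',
        slopeTrace_neg_neg, add_comm q', add_comm p'] at this
      linarith
  · rcases lt_or_ge 0 q' with hq' | hq'
    · have := slopeTrace_add_sub_of_nonneg r (q := q') (p := p') (q' := -q) (p' := -p)
        hq' (by omega) (by linear_combination hd)
      rw [slopeTrace_neg_neg, ← sub_eq_add_neg, ← sub_eq_add_neg, sub_neg_eq_add, sub_neg_eq_add,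
        add_comm q', add_comm p'] at this
      linarith
    · rcases hq.eq_or_lt with rfl | hq
      · have h1 : p * (-q') = 1 := by linear_combination hd
        have h2 : q' = -1 := by
          rcases Int.eq_one_or_neg_one_of_mul_eq_one' h1 with h | h <;> omega
        subst h2
        have := slopeTrace_add_sub_of_nonneg r (q := 1) (p := -p') (q' := 0) (p' := p)
          (by omega) le_rfl (by linear_combination hd)
        have e1 := slopeTrace_neg_neg r (-1) p'
        have e2 : slopeTrace r (1 + 0) (-p' + p) = slopeTrace r (0 - -1) (p - p') := by
          congr 1; ring
        have e3 : slopeTrace r (1 - 0) (-p' - p) = slopeTrace r (0 + -1) (p + p') := by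
          rw [← slopeTrace_neg_neg]
          congr 1; ring
        rw [neg_neg] at e1
        rw [e1, e2, e3] at this
        linarith
      · have := slopeTrace_add_sub_of_nonneg r (q := -q) (p := -p) (q' := -q') (p' := -p')
          (by omega) (by omega) (by linear_combination hd)
        rw [slopeTrace_neg_neg, slopeTrace_neg_neg, ← neg_add, ← neg_add, slopeTrace_neg_neg,
          neg_sub_neg, neg_sub_neg] at this
        linarith

theorem isMarkov_slopeTrace (r : F₂ →* SL(2, ℝ)) (hx : 2 < tr (r x))
    (hy : 2 < tr (r y))
    (h : fricke (tr (r x)) (tr (r y)) (tr (r x * r y)) < 0) :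
    IsMarkov (slopeTrace r) where
  even := slopeTrace_neg_neg r
  add_sub _ _ _ _ hd := slopeTrace_add_sub r hd
  two_lt_one_zero := by simpa [slopeTrace, slopeCurve_one] using hx
  two_lt_zero_one := by simpa [slopeTrace, slopeCurve_zero] using hy
  fricke_neg := by
    simpa only [slopeTrace, slopeCurve_one, slopeCurve_zero, map_mul, zpow_zero, zpow_one, map_one,
      mul_one] using h

/-! ### Möbius transformations and the distance to an axis -/

theorem det_eq (A : SL(2, ℝ)) : A 0 0 * A 1 1 - A 0 1 * A 1 0 = 1 := by
  have := A.det_coe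
  rwa [Matrix.det_fin_two] at this

/-- The squared norm of the denominator of the Möbius transformation `A` at `z`. -/
def denomSq (A : SL(2, ℝ)) (z : ℍ) : ℝ := (A 1 0 * z.re + A 1 1) ^ 2 + (A 1 0 * z.im) ^ 2

theorem denomSq_pos (A : SL(2, ℝ)) (z : ℍ) : 0 < denomSq A z := by
  unfold denomSq
  have hd := det_eq A
  have hz := z.im_pos
  by_contra! h
  have h1 : A 1 0 * z.im = 0 := by
    nlinarith [sq_nonneg (A 1 0 * z.re + A 1 1), sq_nonneg (A 1 0 * z.im)]
  have h2 : A 1 0 = 0 := (mul_eq_zero.mp h1).resolve_right hz.ne'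
  rw [h2] at h hd
  have h3 : A 1 1 = 0 := by nlinarith [sq_nonneg (A 1 1)]
  rw [h3] at hd
  simp at hd

theorem smul_re_im (A : SL(2, ℝ)) (z : ℍ) :
    (A • z).re = (A 0 0 * A 1 0 * (z.re ^ 2 + z.im ^ 2) + (A 0 0 * A 1 1 + A 0 1 * A 1 0) * z.re +
      A 0 1 * A 1 1) / denomSq A z ∧ (A • z).im = z.im / denomSq A z := by
  have hN := (denomSq_pos A z).ne'
  have hd := det_eq A
  have h := UpperHalfPlane.coe_specialLinearGroup_apply A z
  have hre := congrArg Complex.re h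
  have him := congrArg Complex.im h
  have e : Complex.normSq ((A 1 0 : ℂ) * z + A 1 1) = denomSq A z := by
    rw [Complex.normSq_apply, denomSq]
    simp
    ring
  simp only [Complex.div_re, Complex.div_im, UpperHalfPlane.coe_re, UpperHalfPlane.coe_im,
    Algebra.algebraMap_self, RingHom.id_apply, e] at hre him
  simp at hre him
  rw [hre, him]
  generalize denomSq A z = N at *
  constructor
  · field_simp
    ring
  · field_simp
    linear_combination hd

/-- The function on `ℍ` that is a multiple of the hyperbolic sine of the signed distance to the
axis of `A`, when `A` is hyperbolic. -/
noncomputable def axisFun (A : SL(2, ℝ)) (z : ℍ) : ℝ :=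
  (A 1 0 * (z.re ^ 2 + z.im ^ 2) + (A 1 1 - A 0 0) * z.re - A 0 1) / z.im

theorem continuous_axisFun (A : SL(2, ℝ)) : Continuous (axisFun A) := by
  unfold axisFun
  have h1 := UpperHalfPlane.continuous_re
  have h2 := UpperHalfPlane.continuous_im
  exact Continuous.div (by fun_prop) h2 fun z => z.im_pos.ne'

theorem axisFun_smul (A g : SL(2, ℝ)) (z : ℍ) : axisFun A (g • z) = axisFun (g⁻¹ * A * g) z := by
  obtain ⟨h1, h2⟩ := smul_re_im g z
  have hN := (denomSq_pos g z).ne'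
  have hd := det_eq g
  have hz := z.im_pos.ne'
  have e : (g • z).re ^ 2 + (g • z).im ^ 2 =
      ((g 0 0 * z.re + g 0 1) ^ 2 + (g 0 0 * z.im) ^ 2) / denomSq g z := by
    have hNd : denomSq g z = (g 1 0 * z.re + g 1 1) ^ 2 + (g 1 0 * z.im) ^ 2 := rfl
    rw [h1, h2]
    generalize denomSq g z = N at *
    field_simp
    rw [hNd]
    linear_combination (-z.im ^ 2 * (g 0 0 * g 1 1 - g 0 1 * g 1 0 + 1)) * hd
  have hNd : denomSq g z = (g 1 0 * z.re + g 1 1) ^ 2 + (g 1 0 * z.im) ^ 2 := rfl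
  unfold axisFun
  rw [e, h1, h2]
  simp only [Matrix.SpecialLinearGroup.coe_mul, Matrix.SpecialLinearGroup.coe_inv,
    Matrix.adjugate_fin_two, Matrix.mul_apply, Fin.sum_univ_two, Matrix.of_apply,
    Matrix.cons_val', Matrix.cons_val_zero, Matrix.cons_val_one, Matrix.cons_val_fin_one]
  generalize denomSq g z = N at *
  field_simp
  rw [hNd]
  ring

theorem axisFun_zpow_smul (A : SL(2, ℝ)) (n : ℤ) (z : ℍ) :
    axisFun A (A ^ n • z) = axisFun A z := by
  rw [axisFun_smul]
  congr 1
  group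

/-- The displacement of `A` at `z` in terms of the trace and of the distance from `z` to the
axis. -/
theorem four_mul_sinh_sq (A : SL(2, ℝ)) (z : ℍ) :
    4 * Real.sinh (dist z (A • z) / 2) ^ 2 = tr A ^ 2 - 4 + axisFun A z ^ 2 := by
  obtain ⟨h1, h2⟩ := smul_re_im A z
  have hN := denomSq_pos A z
  have hd := det_eq A
  have hz := z.im_pos
  have hw : 0 < (A • z).im := (A • z).im_pos
  rw [UpperHalfPlane.sinh_half_dist, div_pow, mul_pow, Real.sq_sqrt (by positivity),
    Complex.dist_eq, ← Complex.normSq_eq_norm_sq, Complex.normSq_apply]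
  simp only [Complex.sub_re, Complex.sub_im, UpperHalfPlane.coe_re, UpperHalfPlane.coe_im]
  have hNd : denomSq A z = (A 1 0 * z.re + A 1 1) ^ 2 + (A 1 0 * z.im) ^ 2 := rfl
  rw [h1, h2, axisFun, tr]
  generalize denomSq A z = N at *
  generalize A 0 0 = a at *
  generalize A 0 1 = b at *
  generalize A 1 0 = c at *
  generalize A 1 1 = d at *
  generalize z.re = u at *
  generalize z.im = v at *
  have hN' := hN.ne'
  have hz' := hz.ne'
  field_simp
  -- `z - A z = Q conj D / N`, for `D = c z + d` and the quadratic form `Q` that vanishes at the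
  -- fixed points of `A`
  have e1 : u * N - (a * c * (u ^ 2 + v ^ 2) + u * (a * d + c * b) + d * b) =
      (c * (u ^ 2 - v ^ 2) + (d - a) * u - b) * (c * u + d) +
        (2 * c * u * v + (d - a) * v) * (c * v) := by
    rw [hNd]; ring
  have e2 : v * (N - 1) = (2 * c * u * v + (d - a) * v) * (c * u + d) -
      (c * (u ^ 2 - v ^ 2) + (d - a) * u - b) * (c * v) := by
    rw [hNd]; linear_combination v * hd
  rw [e1, ← mul_pow, e2, hNd]
  linear_combination -16 * v ^ 2 * ((c * u + d) ^ 2 + (c * v) ^ 2) * hd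

/-! ### Hyperbolic elements and crossing axes -/

/-- The diagonal matrix with entries `s`, `s⁻¹`. -/
noncomputable def diag (s : ℝˣ) : SL(2, ℝ) :=
  ⟨!![(s : ℝ), 0; 0, ((s⁻¹ : ℝˣ) : ℝ)], by simp [Matrix.det_fin_two]⟩

@[simp] theorem diag_zero_zero (s : ℝˣ) : diag s 0 0 = s := rfl

@[simp] theorem diag_zero_one (s : ℝˣ) : diag s 0 1 = 0 := rfl

@[simp] theorem diag_one_zero (s : ℝˣ) : diag s 1 0 = 0 := rfl

@[simp] theorem diag_one_one (s : ℝˣ) : diag s 1 1 = (s : ℝ)⁻¹ := Units.val_inv_eq_inv_val s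

theorem exists_conj_diag {A : SL(2, ℝ)} (hA : 2 < |tr A|) :
    ∃ (h : SL(2, ℝ)) (s : ℝˣ), 1 < (s : ℝ) ^ 2 ∧ A = h * diag s * h⁻¹ := by
  have hA2 : 4 < tr A ^ 2 := by
    rw [← sq_abs]; nlinarith
  obtain ⟨s, hs1, hs⟩ : ∃ s : ℝ, 1 < s ^ 2 ∧ s * (tr A - s) = 1 := by
    have h0 : 0 < tr A ^ 2 - 4 := by linarith
    have h1 := Real.sq_sqrt h0.le
    have h2 := Real.sqrt_pos.mpr h0
    rcases le_total 0 (tr A) with ht | ht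
    · rw [abs_of_nonneg ht] at hA
      exact ⟨(tr A + √(tr A ^ 2 - 4)) / 2, by nlinarith, by linear_combination -h1 / 4⟩
    · rw [abs_of_nonpos ht] at hA
      exact ⟨(tr A - √(tr A ^ 2 - 4)) / 2, by nlinarith, by linear_combination -h1 / 4⟩
  set r := tr A - s with hr
  have htr : A 0 0 + A 1 1 = s + r := by rw [hr, ← tr]; ring
  clear_value r
  have hsr : s - r ≠ 0 := by
    intro h
    have h1 : r = s := by linarith
    rw [h1] at hs
    nlinarith
  have hd := det_eq A
  suffices ∃ h : SL(2, ℝ), A * h = h * diag ⟨s, r, hs, by rw [mul_comm, hs]⟩ by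
    obtain ⟨h, hh⟩ := this
    exact ⟨h, _, hs1, by rw [← hh, mul_inv_cancel_right]⟩
  have build : ∀ a b c d : ℝ, a * d - b * c = 1 → A 0 0 * a + A 0 1 * c = a * s →
      A 0 0 * b + A 0 1 * d = b * r → A 1 0 * a + A 1 1 * c = c * s →
      A 1 0 * b + A 1 1 * d = d * r →
      ∃ h : SL(2, ℝ), A * h = h * diag ⟨s, r, hs, by rw [mul_comm, hs]⟩ := by
    intro a b c d h0 h1 h2 h3 h4
    obtain ⟨h, h00, h01, h10, h11⟩ :
        ∃ h : SL(2, ℝ), h 0 0 = a ∧ h 0 1 = b ∧ h 1 0 = c ∧ h 1 1 = d :=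
      ⟨⟨!![a, b; c, d], by rw [Matrix.det_fin_two]; exact h0⟩, rfl, rfl, rfl, rfl⟩
    have hrs : s⁻¹ = r := (eq_inv_of_mul_eq_one_right hs).symm
    refine ⟨h, ?_⟩
    ext i j
    fin_cases i <;> fin_cases j <;>
      simp [Matrix.SpecialLinearGroup.coe_mul, Matrix.mul_apply, Fin.sum_univ_two, h00, h01, h10,
        h11, h1, h2, h3, h4, hrs]
  by_cases hc : A 1 0 = 0
  · rw [hc] at hd
    have h1 : (A 0 0 - s) * (A 0 0 - r) = 0 := by
      linear_combination -hd + hs + A 0 0 * htr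
    rcases mul_eq_zero.mp h1 with h | h
    · refine build 1 (-A 0 1 / (s - r)) 0 1 (by ring) (by linarith) ?_ (by linarith) ?_
      · field_simp
        linear_combination -A 0 1 * h
      · rw [hc]; linear_combination htr - h
    · refine build (A 0 1 / (s - r)) (-1) 1 0 (by ring) ?_ (by linarith) ?_ (by linarith)
      · field_simp
        linear_combination A 0 1 * h
      · rw [hc]; linear_combination htr - h
  · refine build ((s - A 1 1) / (A 1 0 * (s - r))) (r - A 1 1) (A 1 0 / (A 1 0 * (s - r))) (A 1 0)
      ?_ ?_ ?_ ?_ ?_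
    · field_simp
      ring
    · field_simp
      linear_combination -hd + hs + s * htr
    · linear_combination -hd + hs + r * htr
    · field_simp
      ring
    · ring

theorem diag_smul (s : ℝˣ) (z : ℍ) :
    (diag s • z).re = (s : ℝ) ^ 2 * z.re ∧ (diag s • z).im = (s : ℝ) ^ 2 * z.im := by
  obtain ⟨h1, h2⟩ := smul_re_im (diag s) z
  have hs : (s : ℝ) ≠ 0 := s.ne_zero
  rw [h1, h2, denomSq]
  simp only [diag_zero_zero, diag_zero_one, diag_one_zero, diag_one_one]
  constructor <;> field_simp <;> ring

theorem diag_zpow (s : ℝˣ) (n : ℤ) : diag s ^ n = diag (s ^ n) := by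
  have hmul : ∀ s t : ℝˣ, diag (s * t) = diag s * diag t := by
    intro s t
    ext i j
    fin_cases i <;> fin_cases j <;>
      simp [Matrix.SpecialLinearGroup.coe_mul, Matrix.mul_apply, Fin.sum_univ_two, mul_comm]
  exact (map_zpow (MonoidHom.mk' diag hmul) s n).symm

theorem tr_conj (h A : SL(2, ℝ)) : tr (h⁻¹ * A * h) = tr A := by
  rw [tr_mul_comm, mul_inv_cancel_left]

/-- Fermi coordinates along the axis of a hyperbolic element `A`: the lines `{k} × ℝ` are the curves
at constant distance from the axis, along which `A` acts by translation. -/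
theorem exists_fermiCoordinates {A : SL(2, ℝ)} (hA : 2 < |tr A|) :
    ∃ (Φ : ℝ × ℝ → ℍ) (ℓ : ℝ), 0 < ℓ ∧ Continuous Φ ∧ Function.Surjective Φ ∧
      (∀ u, axisFun A (Φ u) = u.1) ∧ ∀ (n : ℤ) (u), A ^ n • Φ u = Φ (u.1, u.2 + n * ℓ) := by
  obtain ⟨h, s, hs, rfl⟩ := exists_conj_diag hA
  have hs0 : (s : ℝ) ≠ 0 := s.ne_zero
  set c : ℝ := (s : ℝ)⁻¹ - s with hc
  have hc0 : c ≠ 0 := by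
    intro h0
    have : (s : ℝ) * s = 1 := by
      rw [hc, sub_eq_zero] at h0
      nth_rewrite 1 [← h0]
      exact inv_mul_cancel₀ hs0
    nlinarith
  let Ψ : ℝ × ℝ → ℍ := fun u =>
    ⟨⟨u.1 / c * Real.exp u.2, Real.exp u.2⟩, Real.exp_pos _⟩
  have hΨre : ∀ u, (Ψ u).re = u.1 / c * Real.exp u.2 := fun u => rfl
  have hΨim : ∀ u, (Ψ u).im = Real.exp u.2 := fun u => rfl
  have hΨ : Continuous Ψ := by
    rw [UpperHalfPlane.isEmbedding_coe.continuous_iff]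
    have : ((↑) : ℍ → ℂ) ∘ Ψ = fun u =>
        ((u.1 / c * Real.exp u.2 : ℝ) : ℂ) + (Real.exp u.2 : ℝ) * Complex.I := by
      funext u
      refine Complex.ext ?_ ?_ <;> simp only [Function.comp_apply, Ψ, Complex.add_re,
        Complex.add_im, Complex.ofReal_re, Complex.ofReal_im, Complex.re_ofReal_mul,
        Complex.im_ofReal_mul, Complex.I_re, Complex.I_im, mul_zero, mul_one, add_zero, zero_add]
    rw [this]
    fun_prop
  refine ⟨fun u => h • Ψ u, Real.log ((s : ℝ) ^ 2), Real.log_pos hs, ?_, ?_, ?_, ?_⟩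
  · exact hΨ.const_smul h
  · intro z
    refine ⟨(c * ((h⁻¹ • z).re / (h⁻¹ • z).im), Real.log (h⁻¹ • z).im), ?_⟩
    have hz : 0 < (h⁻¹ • z).im := (h⁻¹ • z).im_pos
    rw [← eq_inv_smul_iff]
    refine UpperHalfPlane.ext_re_im ?_ ?_
    · rw [hΨre, Real.exp_log hz]
      field_simp
    · rw [hΨim, Real.exp_log hz]
  · intro u
    have e : h⁻¹ * (h * diag s * h⁻¹) * h = diag s := by group
    rw [axisFun_smul, e, axisFun, hΨre, hΨim]
    have := Real.exp_pos u.2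
    simp only [diag_zero_zero, diag_zero_one, diag_one_zero, diag_one_one, ← hc]
    field_simp
    ring
  · intro n u
    simp only [conj_zpow, mul_smul, inv_smul_smul, diag_zpow]
    congr 1
    obtain ⟨h1, h2⟩ := diag_smul (s ^ n) (Ψ u)
    have e : Real.exp (n * Real.log ((s : ℝ) ^ 2)) = ((s ^ n : ℝˣ) : ℝ) ^ 2 := by
      rw [mul_comm, Real.exp_mul, Real.exp_log (by positivity), Real.rpow_intCast,
        Units.val_zpow_eq_zpow_val,
        ← zpow_natCast, ← zpow_natCast, ← zpow_mul, ← zpow_mul, mul_comm]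
    refine UpperHalfPlane.ext_re_im ?_ ?_
    · rw [h1, hΨre, hΨre, Real.exp_add, e]
      ring
    · rw [h2, hΨim, hΨim, Real.exp_add, e]
      ring

/-- The values of `axisFun A` along an orbit of a hyperbolic element `B`. The sign of the product
`q r` of the extreme coefficients is opposite to that of `tr [A, B] - 2`. -/
theorem exists_axisFun_orbit {B : SL(2, ℝ)} (hB : 2 < |tr B|) (A : SL(2, ℝ)) :
    ∃ (h : SL(2, ℝ)) (μ q r e c : ℝ), 1 < μ ∧ 0 < c ∧
      fricke (tr A) (tr B) (tr (A * B)) = -(c * (q * r)) ∧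
      ∀ (w : ℍ) (n : ℤ), axisFun A (B ^ n • h • w) =
        (r * (w.re ^ 2 + w.im ^ 2) * μ ^ n + e * w.re - q * (μ ^ n)⁻¹) / w.im := by
  obtain ⟨h, s, hs, rfl⟩ := exists_conj_diag hB
  have hs0 : (s : ℝ) ≠ 0 := s.ne_zero
  set A' := h⁻¹ * A * h with hA'
  refine ⟨h, (s : ℝ) ^ 2, A' 0 1, A' 1 0, A' 1 1 - A' 0 0, ((s : ℝ) - (s : ℝ)⁻¹) ^ 2, hs, ?_, ?_,
    fun w n => ?_⟩
  · have : (s : ℝ) - (s : ℝ)⁻¹ ≠ 0 := by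
      intro h0
      rw [sub_eq_zero] at h0
      have : (s : ℝ) * s = 1 := by
        nth_rewrite 2 [h0]
        exact mul_inv_cancel₀ hs0
      nlinarith
    positivity
  · have e1 : tr A = tr A' := (tr_conj h A).symm
    have e2 : tr (h * diag s * h⁻¹) = tr (diag s) := by
      rw [← tr_conj h]; congr 1; group
    have e3 : tr (A * (h * diag s * h⁻¹)) = tr (A' * diag s) := by
      rw [← tr_conj h]; congr 1; rw [hA']; group
    have hd := det_eq A'
    rw [e1, e2, e3, fricke]
    simp only [tr, Matrix.SpecialLinearGroup.coe_mul, Matrix.mul_apply, Fin.sum_univ_two,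
      diag_zero_zero, diag_zero_one, diag_one_zero, diag_one_one]
    field_simp
    linear_combination (-((s : ℝ) ^ 2 - 1) ^ 2) * hd
  · rw [conj_zpow, mul_smul, mul_smul, inv_smul_smul, axisFun_smul, diag_zpow, ← hA', axisFun]
    obtain ⟨h1, h2⟩ := diag_smul (s ^ n) w
    have e : ((s : ℝ) ^ 2) ^ n = ((s ^ n : ℝˣ) : ℝ) ^ 2 := by
      rw [Units.val_zpow_eq_zpow_val, ← zpow_natCast, ← zpow_natCast, ← zpow_mul, ← zpow_mul,
        mul_comm]
    rw [h1, h2, e]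
    have hw := w.im_pos.ne'
    have hsn : ((s ^ n : ℝˣ) : ℝ) ≠ 0 := (s ^ n).ne_zero
    generalize ((s ^ n : ℝˣ) : ℝ) = σ at *
    field_simp

theorem exists_pow_pos {μ α : ℝ} (hμ : 1 < μ) (hα : 0 < α) (β γ : ℝ) :
    ∃ n : ℕ, 0 < α * μ ^ n + β - γ * (μ ^ n)⁻¹ := by
  obtain ⟨n, hn⟩ := pow_unbounded_of_one_lt ((|β| + |γ|) / α) hμ
  refine ⟨n, ?_⟩
  rw [div_lt_iff₀ hα] at hn
  have h1 : 1 ≤ μ ^ n := one_le_pow₀ hμ.le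
  have h2 : (μ ^ n)⁻¹ ≤ 1 := inv_le_one_of_one_le₀ h1
  have h3 : 0 ≤ (μ ^ n)⁻¹ := by positivity
  have h4 : γ * (μ ^ n)⁻¹ ≤ |γ| := by
    nlinarith [le_abs_self γ, abs_nonneg γ]
  linarith [neg_abs_le β]

/-- If the axes of `A` and `B` cross, then every orbit of `B` goes far away on both sides
of the axis of `A`. -/
theorem exists_lt_axisFun {A B : SL(2, ℝ)} (hB : 2 < |tr B|)
    (h : fricke (tr A) (tr B) (tr (A * B)) < 0) (z : ℍ) (C : ℝ) :
    (∃ n : ℤ, C < axisFun A (B ^ n • z)) ∧ ∃ n : ℤ, axisFun A (B ^ n • z) < -C := by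
  obtain ⟨g, μ, q, r, e, c, hμ, hc, hf, H⟩ := exists_axisFun_orbit hB A
  have hqr : 0 < q * r := by
    by_contra! h0
    nlinarith
  set w := g⁻¹ • z with hw
  have hz : z = g • w := by rw [hw, smul_inv_smul]
  have hN : 0 < w.re ^ 2 + w.im ^ 2 := by
    have := w.im_pos
    positivity
  have hp : ∀ n : ℤ, 0 < r * (w.re ^ 2 + w.im ^ 2) * μ ^ n + (e * w.re - C * w.im) - q * (μ ^ n)⁻¹ →
      C < axisFun A (B ^ n • z) := fun n hn => by
    rw [hz, H, lt_div_iff₀ w.im_pos]; linarith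
  have hm : ∀ n : ℤ,
      0 < (-r) * (w.re ^ 2 + w.im ^ 2) * μ ^ n + (-e * w.re - C * w.im) - (-q) * (μ ^ n)⁻¹ →
      axisFun A (B ^ n • z) < -C := fun n hn => by
    rw [hz, H, div_lt_iff₀ w.im_pos]; linarith
  -- depending on the signs, the attracting and the repelling ends of the orbit are used
  rcases lt_or_ge 0 r with hr | hr
  · have hq : 0 < q := pos_of_mul_pos_left hqr hr.le
    obtain ⟨n, hn⟩ := exists_pow_pos hμ (mul_pos hr hN) (e * w.re - C * w.im) q
    obtain ⟨m, hm'⟩ := exists_pow_pos hμ hq (-e * w.re - C * w.im) (r * (w.re ^ 2 + w.im ^ 2))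
    refine ⟨⟨n, hp n (by exact_mod_cast hn)⟩, ⟨-m, hm _ ?_⟩⟩
    rw [zpow_neg, inv_inv, zpow_natCast]
    linarith
  · have hr' : 0 < -r := by
      rcases hr.eq_or_lt with rfl | hr
      · simp at hqr
      · linarith
    have hq : 0 < -q := by nlinarith
    obtain ⟨n, hn⟩ := exists_pow_pos hμ (mul_pos hr' hN) (-e * w.re - C * w.im) (-q)
    obtain ⟨m, hm'⟩ := exists_pow_pos hμ hq (e * w.re - C * w.im) (-r * (w.re ^ 2 + w.im ^ 2))
    refine ⟨⟨-m, hp _ ?_⟩, ⟨n, hm n (by exact_mod_cast hn)⟩⟩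
    rw [zpow_neg, inv_inv, zpow_natCast]
    linarith

/-- If the axes of `A` and `B` do not cross, then some orbit of `B`, on its axis, stays on one side
of the axis of `A`. -/
theorem exists_axisFun_orbit_sign {A B : SL(2, ℝ)} (hB : 2 < |tr B|)
    (h : 0 ≤ fricke (tr A) (tr B) (tr (A * B))) :
    ∃ z : ℍ, (∀ n : ℤ, 0 ≤ axisFun A (B ^ n • z)) ∨ ∀ n : ℤ, axisFun A (B ^ n • z) ≤ 0 := by
  obtain ⟨g, μ, q, r, e, c, hμ, hc, hf, H⟩ := exists_axisFun_orbit hB A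
  have hqr : q * r ≤ 0 := by
    by_contra! h0
    nlinarith [mul_pos hc h0]
  refine ⟨g • UpperHalfPlane.I, ?_⟩
  have hval : ∀ n : ℤ, axisFun A (B ^ n • g • UpperHalfPlane.I) = r * μ ^ n - q * (μ ^ n)⁻¹ := by
    intro n
    rw [H]
    simp
  have hμn : ∀ n : ℤ, 0 < μ ^ n := fun n => zpow_pos (by linarith) n
  simp only [hval]
  rcases lt_trichotomy r 0 with hr | rfl | hr
  · right
    intro n
    have hq : 0 ≤ q := by nlinarith
    have h1 := mul_pos (neg_pos.mpr hr) (hμn n)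
    have h2 := mul_nonneg hq (inv_pos.mpr (hμn n)).le
    linarith
  · rcases le_total 0 q with hq | hq
    · right
      intro n
      have h2 := mul_nonneg hq (inv_pos.mpr (hμn n)).le
      linarith
    · left
      intro n
      have h2 := mul_nonneg (neg_nonneg.mpr hq) (inv_pos.mpr (hμn n)).le
      linarith
  · left
    intro n
    have hq : q ≤ 0 := by nlinarith
    have h1 := mul_pos hr (hμn n)
    have h2 := mul_nonneg (neg_nonneg.mpr hq) (inv_pos.mpr (hμn n)).le
    linarith

/-! ### Topology of the sides of an axis -/

/-- A continuous function that is invariant under a hyperbolic element is bounded on the tubes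
around its axis, which have compact quotients. -/
theorem exists_bound_of_invariant {A : SL(2, ℝ)} (hA : 2 < |tr A|) {f : ℍ → ℝ} (hf : Continuous f)
    (hinv : ∀ (n : ℤ) (z), f (A ^ n • z) = f z) (C : ℝ) :
    ∃ M, ∀ z, |axisFun A z| ≤ C → |f z| ≤ M := by
  obtain ⟨Φ, ℓ, hℓ, hΦ, hsurj, haxis, hsmul⟩ := exists_fermiCoordinates hA
  obtain ⟨M, hM⟩ := ((isCompact_Icc (a := -C) (b := C)).prod
    (isCompact_Icc (a := 0) (b := ℓ))).exists_bound_of_continuousOn (hf.comp hΦ).continuousOn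
  refine ⟨M, fun z hz => ?_⟩
  obtain ⟨u, rfl⟩ := hsurj z
  rw [haxis] at hz
  rw [← hinv (-⌊u.2 / ℓ⌋), hsmul]
  refine hM _ ⟨abs_le.mp hz, ?_⟩
  have h1 := (le_div_iff₀ hℓ).mp (Int.floor_le (u.2 / ℓ))
  have h2 := (div_lt_iff₀ hℓ).mp (Int.lt_floor_add_one (u.2 / ℓ))
  push_cast
  constructor
  · linarith
  · linarith

theorem isPreconnected_axisFun_preimage {A : SL(2, ℝ)} (hA : 2 < |tr A|) {I : Set ℝ}
    (hI : Convex ℝ I) : IsPreconnected (axisFun A ⁻¹' I) := by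
  obtain ⟨Φ, ℓ, -, hΦ, hsurj, haxis, -⟩ := exists_fermiCoordinates hA
  have : axisFun A ⁻¹' I = Φ '' (I ×ˢ Set.univ) := by
    ext z
    obtain ⟨u, rfl⟩ := hsurj z
    constructor
    · intro h
      rw [Set.mem_preimage, haxis] at h
      exact ⟨u, ⟨h, trivial⟩, rfl⟩
    · rintro ⟨v, ⟨hv, -⟩, hvu⟩
      rw [Set.mem_preimage, ← hvu, haxis]
      exact hv
  rw [this]
  exact (hI.prod convex_univ).isPreconnected.image _ hΦ.continuousOn

theorem axisFun_surjective {A : SL(2, ℝ)} (hA : 2 < |tr A|) :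
    Function.Surjective (axisFun A) := by
  obtain ⟨Φ, -, -, -, -, haxis, -⟩ := exists_fermiCoordinates hA
  exact fun k => ⟨Φ (k, 0), haxis _⟩

theorem pos_or_neg_of_isPreconnected {S : Set ℍ} (hS : IsPreconnected S) {f : ℍ → ℝ}
    (hf : Continuous f) (h0 : ∀ z ∈ S, f z ≠ 0) : (∀ z ∈ S, 0 < f z) ∨ ∀ z ∈ S, f z < 0 := by
  by_contra! h
  obtain ⟨⟨z, hz, hfz⟩, w, hw, hfw⟩ := h
  obtain ⟨u, hu, hu0⟩ := hS.intermediate_value hz hw hf.continuousOn ⟨hfz, hfw⟩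
  exact h0 u hu hu0

/-- A homeomorphism that conjugates one hyperbolic element to another sends the two sides of the
first axis, outside of a tube, into different sides of the second axis. Otherwise one side of the
second axis would come from the tube and so have a compact quotient. -/
theorem exists_sides {X A : SL(2, ℝ)} (hX : 2 < |tr X|) (hA : 2 < |tr A|) (dev : ℍ ≃ₜ ℍ)
    (hdev : ∀ (n : ℤ) (z : ℍ), dev (X ^ n • z) = A ^ n • dev z) :
    ∃ C : ℝ, ((∀ z, C < axisFun X z → 0 < axisFun A (dev z)) ∧
        ∀ z, axisFun X z < -C → axisFun A (dev z) < 0) ∨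
      ((∀ z, C < axisFun X z → axisFun A (dev z) < 0) ∧
        ∀ z, axisFun X z < -C → 0 < axisFun A (dev z)) := by
  have hf : Continuous fun z => axisFun A (dev z) := (continuous_axisFun A).comp dev.continuous
  obtain ⟨C, hC⟩ := exists_bound_of_invariant hA (f := fun z => axisFun X (dev.symm z))
    ((continuous_axisFun X).comp dev.symm.continuous) (fun n z => by
      have : dev.symm (A ^ n • z) = X ^ n • dev.symm z := by
        rw [Homeomorph.symm_apply_eq, hdev, Homeomorph.apply_symm_apply]
      rw [this, axisFun_zpow_smul]) 0
  have hzero : ∀ z, axisFun A (dev z) = 0 → |axisFun X z| ≤ C := fun z hz => by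
    simpa using hC (dev z) (by rw [hz, abs_zero])
  obtain ⟨M, hM⟩ := exists_bound_of_invariant hX hf
    (fun n z => by rw [hdev, axisFun_zpow_smul]) C
  have h1 := pos_or_neg_of_isPreconnected
    (isPreconnected_axisFun_preimage hX (convex_Ioi C)) hf
    (fun z hz h0 => absurd (le_abs_self (axisFun X z)) (not_le.mpr ((hzero z h0).trans_lt hz)))
  have h2 := pos_or_neg_of_isPreconnected
    (isPreconnected_axisFun_preimage hX (convex_Iio (-C))) hf
    (fun z hz h0 => by
      have := neg_le_of_abs_le (hzero z h0)
      exact absurd this (not_le.mpr hz))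
  refine ⟨C, ?_⟩
  rcases h1 with h1 | h1 <;> rcases h2 with h2 | h2
  · exfalso
    obtain ⟨w, hw⟩ := axisFun_surjective hA (-|M| - 1)
    obtain ⟨z, rfl⟩ := dev.surjective w
    have hneg : axisFun A (dev z) < 0 := by rw [hw]; linarith [abs_nonneg M]
    have hz : |axisFun X z| ≤ C := by
      by_contra! h
      rcases lt_abs.mp h with h | h
      · exact absurd (h1 z h) (not_lt.mpr hneg.le)
      · exact absurd (h2 z (by simp only [Set.mem_preimage, Set.mem_Iio]; linarith))
          (not_lt.mpr hneg.le)
    have := neg_le_of_abs_le (hM z hz)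
    linarith [le_abs_self M]
  · exact Or.inl ⟨fun z hz => h1 z hz, fun z hz => h2 z hz⟩
  · exact Or.inr ⟨fun z hz => h1 z hz, fun z hz => h2 z hz⟩
  · exfalso
    obtain ⟨w, hw⟩ := axisFun_surjective hA (|M| + 1)
    obtain ⟨z, rfl⟩ := dev.surjective w
    have hpos : 0 < axisFun A (dev z) := by rw [hw]; linarith [abs_nonneg M]
    have hz : |axisFun X z| ≤ C := by
      by_contra! h
      rcases lt_abs.mp h with h | h
      · exact absurd (h1 z h) (not_lt.mpr hpos.le)
      · exact absurd (h2 z (by simp only [Set.mem_preimage, Set.mem_Iio]; linarith))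
          (not_lt.mpr hpos.le)
    have := le_of_abs_le (hM z hz)
    linarith [le_abs_self M]

/-- Whether the axes of two hyperbolic elements cross is preserved by homeomorphisms of the plane
that conjugate the pair to a pair of hyperbolic elements. -/
theorem fricke_neg_of_homeomorph {X Y A B : SL(2, ℝ)} (hX : 2 < |tr X|) (hY : 2 < |tr Y|)
    (hA : 2 < |tr A|) (hB : 2 < |tr B|) (h : fricke (tr X) (tr Y) (tr (X * Y)) < 0)
    (dev : ℍ ≃ₜ ℍ) (hdevX : ∀ (n : ℤ) (z : ℍ), dev (X ^ n • z) = A ^ n • dev z)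
    (hdevY : ∀ (n : ℤ) (z : ℍ), dev (Y ^ n • z) = B ^ n • dev z) :
    fricke (tr A) (tr B) (tr (A * B)) < 0 := by
  by_contra! h0
  obtain ⟨w, hw⟩ := exists_axisFun_orbit_sign hB h0
  obtain ⟨z, rfl⟩ := dev.surjective w
  obtain ⟨C, hC⟩ := exists_sides hX hA dev hdevX
  obtain ⟨⟨n, hn⟩, ⟨m, hm⟩⟩ := exists_lt_axisFun hY h z C
  simp only [← hdevY] at hw
  rcases hC with ⟨h1, h2⟩ | ⟨h1, h2⟩ <;> rcases hw with hw | hw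
  · exact absurd (h2 _ hm) (not_lt.mpr (hw m))
  · exact absurd (h1 _ hn) (not_lt.mpr (hw n))
  · exact absurd (h1 _ hn) (not_lt.mpr (hw n))
  · exact absurd (h2 _ hm) (not_lt.mpr (hw m))

theorem moebius_mk (A : SL(2, ℝ)) (z : ℍ) : moebius (A : PSL(2, ℝ)) z = A • z := rfl

theorem moebius_mk_zpow (A : SL(2, ℝ)) (n : ℤ) (z : ℍ) :
    moebius ((A : PSL(2, ℝ)) ^ n) z = A ^ n • z := by
  rw [← QuotientGroup.mk_zpow, moebius_mk]

/-! ### Translation lengths -/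

theorem translationLength_le (A : SL(2, ℝ)) (z : ℍ) :
    translationLength (A : PSL(2, ℝ)) ≤ dist z (A • z) :=
  ciInf_le (f := fun z => dist z (moebius (A : PSL(2, ℝ)) z))
    ⟨0, by rintro _ ⟨w, rfl⟩; exact dist_nonneg⟩ z

theorem translationLength_eq {A : SL(2, ℝ)} (hA : 2 < tr A) :
    translationLength (A : PSL(2, ℝ)) = 2 * halfLength (tr A) := by
  have hA' : 2 < |tr A| := hA.trans_le (le_abs_self _)
  have hpos := halfLength_pos hA
  have hcosh := two_mul_cosh_halfLength hA
  have hsq := Real.cosh_sq (halfLength (tr A))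
  have key : ∀ z : ℍ, Real.sinh (dist z (A • z) / 2) ^ 2 =
      Real.sinh (halfLength (tr A)) ^ 2 + axisFun A z ^ 2 / 4 := by
    intro z
    have := four_mul_sinh_sq A z
    nlinarith
  have hs0 := Real.sinh_nonneg_iff.mpr hpos.le
  have hs : ∀ z : ℍ, 0 ≤ Real.sinh (dist z (A • z) / 2) := fun z =>
    Real.sinh_nonneg_iff.mpr (div_nonneg dist_nonneg zero_le_two)
  apply le_antisymm
  · obtain ⟨z, hz⟩ := axisFun_surjective hA' 0
    have h1 := key z
    rw [hz] at h1
    have h2 : Real.sinh (dist z (A • z) / 2) = Real.sinh (halfLength (tr A)) :=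
      (sq_eq_sq₀ (hs z) hs0).mp (by linarith)
    have h3 := Real.sinh_injective h2
    have := translationLength_le A z
    linarith
  · refine le_ciInf fun z => ?_
    rw [moebius_mk]
    have h1 : Real.sinh (halfLength (tr A)) ≤ Real.sinh (dist z (A • z) / 2) :=
      (sq_le_sq₀ hs0 (hs z)).mp (by linarith [key z, sq_nonneg (axisFun A z)])
    have := Real.sinh_le_sinh.mp h1
    linarith

/-- Elliptic and parabolic elements have translation length zero. -/
theorem two_lt_abs_tr_of_translationLength_pos {A : SL(2, ℝ)}
    (h : 0 < translationLength (A : PSL(2, ℝ))) : 2 < |tr A| := by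
  by_contra! hA
  have hA2 : tr A ^ 2 ≤ 4 := by
    rw [← sq_abs]; nlinarith [abs_nonneg (tr A)]
  suffices ∀ ε > 0, ∃ z, tr A ^ 2 - 4 + axisFun A z ^ 2 ≤ ε by
    obtain ⟨z, hz⟩ := this (2 * Real.sinh (translationLength (A : PSL(2, ℝ)) / 2) ^ 2) (by
      have := Real.sinh_pos_iff.mpr (half_pos h)
      positivity)
    have h1 := Real.sinh_le_sinh.mpr
      (div_le_div_of_nonneg_right (translationLength_le A z) zero_le_two)
    have h2 := Real.sinh_pos_iff.mpr (half_pos h)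
    have h3 := pow_le_pow_left₀ h2.le h1 2
    have h4 := four_mul_sinh_sq A z
    nlinarith [pow_pos h2 2]
  intro ε hε
  have hd := det_eq A
  by_cases hc : A 1 0 = 0
  · -- `A` is the identity or a parabolic element that fixes `∞`
    rw [hc] at hd
    have h1 : (A 0 0 - A 1 1) ^ 2 ≤ 0 := by
      rw [tr] at hA2
      linarith
    have h2 : A 0 0 = A 1 1 := sub_eq_zero.mp (pow_eq_zero_iff two_ne_zero |>.mp
      (le_antisymm h1 (sq_nonneg _)))
    have hy : 0 < √((A 0 1 ^ 2 + 1) / ε) := Real.sqrt_pos.mpr (by positivity)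
    refine ⟨⟨⟨0, √((A 0 1 ^ 2 + 1) / ε)⟩, hy⟩, ?_⟩
    have hre : (⟨⟨0, √((A 0 1 ^ 2 + 1) / ε)⟩, hy⟩ : ℍ).re = 0 := rfl
    have him : (⟨⟨0, √((A 0 1 ^ 2 + 1) / ε)⟩, hy⟩ : ℍ).im = √((A 0 1 ^ 2 + 1) / ε) := rfl
    rw [axisFun, hre, him, div_pow, Real.sq_sqrt (by positivity), hc, h2, div_div_eq_mul_div]
    simp only [zero_mul, sub_self, add_zero, zero_sub]
    have h3 : (-A 0 1) ^ 2 * ε / (A 0 1 ^ 2 + 1) ≤ ε := by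
      rw [div_le_iff₀ (by positivity)]
      nlinarith
    linarith
  · -- the point just above the fixed point of `A` in the closed upper half-plane
    have hc2 : 0 < A 1 0 ^ 2 := by positivity
    set D := tr A ^ 2 - 4 with hD
    have hy2 : 0 < (-D / 4 + ε) / A 1 0 ^ 2 := div_pos (by linarith) hc2
    have hy : 0 < √((-D / 4 + ε) / A 1 0 ^ 2) := Real.sqrt_pos.mpr hy2
    have hsq := Real.sq_sqrt hy2.le
    set v := √((-D / 4 + ε) / A 1 0 ^ 2) with hv
    let z : ℍ := ⟨⟨(A 0 0 - A 1 1) / (2 * A 1 0), v⟩, hy⟩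
    have hre : z.re = (A 0 0 - A 1 1) / (2 * A 1 0) := rfl
    have him : z.im = v := rfl
    refine ⟨z, ?_⟩
    have hsq' : (A 1 0 * v) ^ 2 = -D / 4 + ε := by
      rw [mul_pow, hsq]; field_simp
    have hnum : A 1 0 * (z.re ^ 2 + z.im ^ 2) + (A 1 1 - A 0 0) * z.re - A 0 1 =
        (ε - D / 2) / A 1 0 := by
      rw [hre, him, eq_div_iff hc, mul_comm]
      have : A 1 0 * (A 1 0 * (((A 0 0 - A 1 1) / (2 * A 1 0)) ^ 2 + v ^ 2) +
          (A 1 1 - A 0 0) * ((A 0 0 - A 1 1) / (2 * A 1 0)) - A 0 1) =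
          (A 1 0 * v) ^ 2 - (A 0 0 - A 1 1) ^ 2 / 4 - A 0 1 * A 1 0 := by
        field_simp
        ring
      rw [this, hsq', hD, tr]
      linear_combination hd
    have h5 : axisFun A z ^ 2 = (ε - D / 2) ^ 2 / (-D / 4 + ε) := by
      rw [axisFun, hnum, him, ← hsq']
      field_simp
    have h6 : 0 < -D / 4 + ε := by linarith
    rw [h5, ← le_sub_iff_add_le', div_le_iff₀ h6]
    nlinarith

/-! ### Holonomy representations -/

/-- An element of `PSL(2, ℝ)` of positive translation length lifts to a matrix of trace greater
than `2`. -/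
theorem exists_lift {g : PSL(2, ℝ)} (hg : 0 < translationLength g) :
    ∃ A : SL(2, ℝ), (A : PSL(2, ℝ)) = g ∧ 2 < tr A := by
  obtain ⟨A, rfl⟩ := QuotientGroup.mk_surjective g
  rcases lt_abs.mp (two_lt_abs_tr_of_translationLength_pos hg) with h | h
  · exact ⟨A, rfl, h⟩
  · refine ⟨-A, ?_, ?_⟩
    · rw [QuotientGroup.eq, Matrix.SpecialLinearGroup.mem_center_iff]
      refine ⟨-1, by simp, ?_⟩
      have : (-A)⁻¹ * A = -1 := by
        rw [inv_mul_eq_iff_eq_mul]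
        simp
      rw [this]
      ext i j
      fin_cases i <;> fin_cases j <;> simp
    · have : tr (-A) = -tr A := by
        simp only [tr, Matrix.SpecialLinearGroup.coe_neg, Matrix.neg_apply]
        ring
      rw [this]
      exact h

/-- A holonomy representation for which the curves `x` and `y` have positive lengths lifts to a
representation in `SL(2, ℝ)` whose traces on simple closed curves solve the Markov equations. -/
theorem exists_isMarkov {ρ : F₂ →* PSL(2, ℝ)} (hρ : IsHolonomy ρ)
    (hx : 0 < curveLength ρ x) (hy : 0 < curveLength ρ y) :
    ∃ r : F₂ →* SL(2, ℝ), (∀ g, (r g : PSL(2, ℝ)) = ρ g) ∧ IsMarkov (slopeTrace r) := by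
  obtain ⟨A, hA, hA2⟩ := exists_lift hx
  obtain ⟨B, hB, hB2⟩ := exists_lift hy
  let r : F₂ →* SL(2, ℝ) := FreeGroup.lift ![A, B]
  have hrx : r x = A := by simp [r, x]
  have hry : r y = B := by simp [r, y]
  have hr : (QuotientGroup.mk' (Subgroup.center SL(2, ℝ))).comp r = ρ := by
    ext i
    fin_cases i
    · exact (congrArg _ hrx).trans hA
    · exact (congrArg _ hry).trans hB
  refine ⟨r, fun g => DFunLike.congr_fun hr g, ?_⟩
  obtain ⟨dev, hdev⟩ := hρ
  let X : SL(2, ℝ) := ⟨!![1, 1; 1, 2], by norm_num [Matrix.det_fin_two]⟩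
  let Y : SL(2, ℝ) := ⟨!![1, -1; -1, 2], by norm_num [Matrix.det_fin_two]⟩
  have hX : deck x = (X : PSL(2, ℝ)) := by simp [deck, x, X]
  have hY : deck y = (Y : PSL(2, ℝ)) := by simp [deck, y, Y]
  have tX : tr X = 3 := show (1 : ℝ) + 2 = 3 by norm_num
  have tY : tr Y = 3 := show (1 : ℝ) + 2 = 3 by norm_num
  have tXY : tr (X * Y) = 3 := by
    rw [tr, Matrix.SpecialLinearGroup.coe_mul]
    norm_num [X, Y, Matrix.mul_apply, Fin.sum_univ_two]
  have key := fricke_neg_of_homeomorph (X := X) (Y := Y) (A := A) (B := B)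
    (by rw [tX]; norm_num) (by rw [tY]; norm_num) (hA2.trans_le (le_abs_self _))
    (hB2.trans_le (le_abs_self _)) (by rw [tX, tY, tXY, fricke]; norm_num) dev
    (fun n z => by
      have := hdev (x ^ n) z
      rwa [map_zpow deck, map_zpow ρ, hX, ← hA, moebius_mk_zpow, moebius_mk_zpow] at this)
    (fun n z => by
      have := hdev (y ^ n) z
      rwa [map_zpow deck, map_zpow ρ, hY, ← hB, moebius_mk_zpow, moebius_mk_zpow] at this)
  exact isMarkov_slopeTrace r (by rw [hrx]; exact hA2) (by rw [hry]; exact hB2)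
    (by rw [hrx, hry]; exact key)

theorem isLengthExtension_stableNorm {ρ : F₂ →* PSL(2, ℝ)} {r : F₂ →* SL(2, ℝ)}
    (hr : ∀ g, (r g : PSL(2, ℝ)) = ρ g) (H : IsMarkov (slopeTrace r)) {a : ℝ} (ha : 0 < a) :
    IsLengthExtension ρ a (stableNorm fun q p => halfLength (slopeTrace r q p) / a) where
  nonneg := (H.isSharplySupported ha).stableNorm_nonneg
  apply_coprime q p hc := by
    rw [(H.isSharplySupported ha).stableNorm_apply hc, curveLength, ← hr,
      translationLength_eq (H.two_lt hc), ← slopeTrace]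
    field_simp
  homogeneous := (H.isSharplySupported ha).stableNorm_smul
  continuous := (H.isSharplySupported ha).continuous_stableNorm

end OneHoledTorus
open OneHoledTorus in
theorem mainTheorem6 (κ : ℝ) (hκ : 1 < κ) :
    ∃ δ : ℝ, 0 < δ ∧
      -- a hyperbolic triangle with inner angles at most `δ` and side lengths `a`, `b`, `c`
      ∀ (P Q R : ℍ), P ≠ Q → Q ≠ R → R ≠ P →
      angleAt P Q R ≤ δ → angleAt Q R P ≤ δ → angleAt R P Q ≤ δ →
      ∀ a b c : ℝ, a = dist Q R → b = dist R P → c = dist P Q →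
      max a (max b c) / min a (min b c) ≤ κ →
      -- the associated representation
      ∀ ρ : F₂ →* PSL(2, ℝ), IsHolonomy ρ → HasInfiniteVolume ρ →
      curveLength ρ (slopeCurve 1 0) = 2 * a →
      curveLength ρ (slopeCurve 1 1) = 2 * b →
      curveLength ρ (slopeCurve 0 1) = 2 * c →
      ∃ L : ℝ × ℝ → ℝ, IsLengthExtension ρ a L ∧
        (∀ L' : ℝ × ℝ → ℝ, IsLengthExtension ρ a L' → L' = L) ∧
        ConvexOn ℝ Set.univ L ∧
        ∀ q p : ℤ, IsCoprime q p →
          IsExtreme ℝ (regionAbove L) (graphRay L q p) ∧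
          {H | IsSupportingPlaneAlong (regionAbove L) (graphRay L q p) H}.Nontrivial := by
  -- every `δ` will do: `tr [A, B] < 2` as soon as the curves `x` and `y` have positive lengths
  refine ⟨1, one_pos, fun P Q R hPQ hQR _ _ _ _ a b c ha _ hc _ ρ hρ _ hx _ hy => ?_⟩
  have ha0 : 0 < a := ha ▸ dist_pos.mpr hQR
  have hc0 : 0 < c := hc ▸ dist_pos.mpr hPQ
  rw [slopeCurve_one, zpow_zero, mul_one] at hx
  rw [slopeCurve_zero] at hy
  obtain ⟨r, hr, H⟩ := exists_isMarkov hρ (by linarith) (by linarith)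
  have hL := isLengthExtension_stableNorm hr H ha0
  have hS := H.isSharplySupported ha0
  exact ⟨_, hL, fun L' hL' => hL.ext hL', hS.convexOn_stableNorm,
    fun q p hqp => ⟨hS.isExtreme_graphRay hqp, hS.nontrivial_supportingPlanes hqp⟩⟩
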